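/- **Theorem 7.** Let $p \ge 2$ be an integer and equip the open unit simplex $\Delta^p = \{ x \in \mathbb{R}^p \mid 0 < x_1, \ldots, x_p < 1, \ \sum_{j=1}^p x_j = 1 \}$ with the Aitchison metric $$ d^2(x, y) = \frac{1}{2p} \sum_{j=1}^p \sum_{k=1}^p \left\{ \log\left(\frac{x_j}{x_k}\right) - \log\left(\frac{y_j}{y_k}\right) \right\}^2 . $$ For a probability distribution $P$ on $\Delta^p$ define the object shape $$ O(P) = \frac{E\{ d(X_1, X_2)^2 d(X_1, X_3)^2 \}}{E\{ d(X_1, X_2)^4 \}}, \qquad X_1, X_2, X_3 \text{ independent draws from } P $$ (whenever the denominator is positive; its value otherwise is immaterial). For $\mu = (\mu_1, \ldots, \mu_p)$ with $\mu_1, \ldots, \mu_p > 0$ and $\theta = (\theta_1, \ldots, \theta_p)$ with $\theta_1, \ldots, \theta_p \ge 0$, let $P_{\mu, \theta}$ denote the distribution on $\Delta^p$ of the random composition $$ \left( \frac{\mu_1 Z_1^{\theta_1}}{\sum_{k=1}^p \mu_k Z_k^{\theta_k}}, \ldots, \frac{\mu_p Z_p^{\theta_p}}{\sum_{k=1}^p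 \mu_k Z_k^{\theta_k}} \right), $$ where $Z_1, \ldots, Z_p$ are independent positive random variables with the same distribution as a positive random variable $Z$. Let $\mu_1, \ldots, \mu_p > 0$ and $\theta_0 > 0$ be fixed, let $1_p = (1, \ldots, 1) \in \mathbb{R}^p$, and assume that $\log Z \sim \mathcal{N}(0, 1)$. Let $X_1, X_2, \ldots$ be independent random elements of $\Delta^p$ with distribution $P_{\mu, \theta_0 1_p}$, and let $P_{\mu, \theta_0 1_p, n} = \frac{1}{n} \sum_{i=1}^n \delta_{X_i}$ be the empirical distribution of $X_1, \ldots, X_n$. Then, as $n \to \infty$, $$ \sqrt{n} \left\{ \frac{2p - 1}{2p + 2} - O(P_{\mu, \theta_0 1_p, n}) \right\} \rightsquigarrow \mathcal{N}\left( 0, \frac{(p - 2)^2}{2 (p + 1)^3 (p - 1)} \right), $$ where $\rightsquigarrow$ denotes convergence in distribution and, for $p = 2$, the limit is the point mass at $0$. -/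

import Mathlib

open MeasureTheory ProbabilityTheory Filter

noncomputable section

/-- The object shape `O(P) = E{d(X₁,X₂)² d(X₁,X₃)²} / E{d(X₁,X₂)⁴}` of a distribution `P` on a
metric space, where `X₁, X₂, X₃` are independent draws from `P`. -/
def objectShape {𝓧 : Type*} [MetricSpace 𝓧] [MeasurableSpace 𝓧] (P : Measure 𝓧) : ℝ :=
  (∫ x : 𝓧 × 𝓧 × 𝓧, dist x.1 x.2.1 ^ 2 * dist x.1 x.2.2 ^ 2 ∂(P.prod (P.prod P))) /
    ∫ x : 𝓧 × 𝓧, dist x.1 x.2 ^ 4 ∂(P.prod P)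

/-- The empirical distribution `n⁻¹ ∑ δ_{xᵢ}` of the first `n` terms of a sequence. -/
def empiricalDistribution {𝓧 : Type*} [MeasurableSpace 𝓧] (n : ℕ) (x : ℕ → 𝓧) : Measure 𝓧 :=
  (n : ENNReal)⁻¹ • ∑ i ∈ Finset.range n, Measure.dirac (x i)

/-- The open unit simplex `{x ∈ ℝᵖ | 0 < x₁, …, x_p < 1, ∑ x_j = 1}`. It is a type of its own,
so that it carries the Aitchison metric rather than the one inherited from `Fin p → ℝ`. -/
def Simplex (p : ℕ) : Type :=
  {x : Fin p → ℝ // (∀ j, 0 < x j ∧ x j < 1) ∧ ∑ j, x j = 1}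

namespace Simplex

variable {p : ℕ}

instance : CoeFun (Simplex p) (fun _ => Fin p → ℝ) := ⟨fun x => x.1⟩

instance : MeasurableSpace (Simplex p) :=
  inferInstanceAs (MeasurableSpace
    {x : Fin p → ℝ // (∀ j, 0 < x j ∧ x j < 1) ∧ ∑ j, x j = 1})

/-- The Aitchison distance. -/
def aitchisonDist (x y : Simplex p) : ℝ :=
  √((1 / (2 * (p : ℝ))) *
    ∑ j, ∑ k, (Real.log (x j / x k) - Real.log (y j / y k)) ^ 2)

/-- The vector of all pairwise log-ratios. -/
def logRatio (x : Simplex p) : EuclideanSpace ℝ (Fin p × Fin p) :=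
  WithLp.toLp 2 fun jk => Real.log (x jk.1 / x jk.2)

theorem aitchisonDist_eq_norm (x y : Simplex p) :
    aitchisonDist x y = √(1 / (2 * (p : ℝ))) * ‖logRatio x - logRatio y‖ := by
  rw [aitchisonDist, Real.sqrt_mul (by positivity), EuclideanSpace.norm_eq, Fintype.sum_prod_type]
  simp [logRatio]

theorem eq_of_aitchisonDist_eq_zero (x y : Simplex p) (h : aitchisonDist x y = 0) : x = y := by
  rcases Nat.eq_zero_or_pos p with rfl | hp
  · exact Subtype.ext (Subsingleton.elim _ _)
  have hp' : (0 : ℝ) < p := by exact_mod_cast hp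
  rw [aitchisonDist_eq_norm, mul_eq_zero, or_iff_right (by positivity), norm_eq_zero,
    sub_eq_zero] at h
  have key : ∀ j k, x j * y k = y j * x k := by
    intro j k
    have h1 := congrArg (fun v : EuclideanSpace ℝ (Fin p × Fin p) => v (j, k)) h
    have hxj := (x.2.1 j).1
    have hxk := (x.2.1 k).1
    have hyj := (y.2.1 j).1
    have hyk := (y.2.1 k).1
    have h2 := Real.log_injOn_pos (Set.mem_Ioi.2 (div_pos hxj hxk))
      (Set.mem_Ioi.2 (div_pos hyj hyk)) h1
    rwa [div_eq_div_iff hxk.ne' hyk.ne'] at h2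
  refine Subtype.ext (funext fun j => ?_)
  have h3 := Finset.sum_congr rfl fun k (_ : k ∈ Finset.univ) => key j k
  rw [← Finset.mul_sum, ← Finset.mul_sum, x.2.2, y.2.2, mul_one, mul_one] at h3
  exact h3

/-- The unit simplex, equipped with the Aitchison metric. -/
instance : MetricSpace (Simplex p) where
  dist := aitchisonDist
  dist_self x := by simp [aitchisonDist]
  dist_comm x y := by simp only [aitchisonDist_eq_norm, norm_sub_rev]
  dist_triangle x y z := by
    simp only [aitchisonDist_eq_norm, ← mul_add]
    exact mul_le_mul_of_nonneg_left (norm_sub_le_norm_sub_add_norm_sub _ _ _) (Real.sqrt_nonneg _)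
  eq_of_dist_eq_zero := eq_of_aitchisonDist_eq_zero _ _

/-- The composition `(w₁, …, w_p) / (w₁ + ⋯ + w_p)` of a vector of positive numbers. -/
def closure (hp : 1 < p) (w : Fin p → ℝ) (hw : ∀ j, 0 < w j) : Simplex p :=
  ⟨fun j => w j / ∑ k, w k, by
    have : NeZero p := ⟨by omega⟩
    have hs : 0 < ∑ k, w k := Finset.sum_pos (fun k _ => hw k) Finset.univ_nonempty
    refine ⟨fun j => ⟨div_pos (hw j) hs, (div_lt_one hs).2 ?_⟩, ?_⟩
    · have : Nontrivial (Fin p) := Fin.nontrivial_iff_two_le.2 hp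
      obtain ⟨k, hk⟩ := exists_ne j
      exact Finset.single_lt_sum hk (Finset.mem_univ j) (Finset.mem_univ k) (hw k)
        fun i _ _ => (hw i).le
    · rw [← Finset.sum_div, div_self hs.ne']⟩

end Simplex

/-- The composition with components `μ_j z_j^{θ_j} / (μ₁ z₁^{θ₁} + ⋯ + μ_p z_p^{θ_p})`. -/
def randomComposition {p : ℕ} (hp : 1 < p) (μ θ : Fin p → ℝ) (hμ : ∀ j, 0 < μ j)
    (z : Fin p → Set.Ioi (0 : ℝ)) : Simplex p :=
  Simplex.closure hp (fun j => μ j * (z j : ℝ) ^ θ j)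
    fun j => mul_pos (hμ j) (Real.rpow_pos_of_pos (z j).2 _)

theorem measurable_randomComposition {p : ℕ} (hp : 1 < p) (μ θ : Fin p → ℝ)
    (hμ : ∀ j, 0 < μ j) : Measurable (randomComposition hp μ θ hμ) := by
  refine Measurable.subtype_mk (measurable_pi_lambda _ fun j => ?_)
  have h : ∀ k, Measurable fun z : Fin p → Set.Ioi (0 : ℝ) => μ k * (z k : ℝ) ^ θ k := fun k =>
    ((measurable_subtype_coe.comp (measurable_pi_apply k)).pow_const _).const_mul _
  exact (h j).div (Finset.measurable_sum _ fun k _ => h k)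

/-- The distribution `P_{μ,θ}` of the random composition generated by a random sample
`Z₁, …, Z_p` from a distribution `F` on the positive half-line. -/
def compositionalDistribution {p : ℕ} (hp : 1 < p) (F : Measure (Set.Ioi (0 : ℝ)))
    (μ θ : Fin p → ℝ) (hμ : ∀ j, 0 < μ j) : Measure (Simplex p) :=
  (Measure.pi fun _ : Fin p => F).map (randomComposition hp μ θ hμ)

end

/-! Put q = p - 1. Logarithms turn the Aitchison metric into the Euclidean metric on the hyperplane
orthogonal to 1_p. Normalising a composition moves its logarithm along 1_p only, so with equal
exponents the projected logarithms are, up to a translation depending on μ and the factor θ₀,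
standard Gaussian vectors Y_i in ℝ^q (`exists_gaussian_coordinates`). The object shape ignores
translations and scale, so only the Y_i matter.

For an empirical distribution, the numerator N and denominator D of the shape are, after θ₀⁴
cancels, polynomials in the sample means of ‖Y‖⁴, ‖Y‖², Y_k Y_l, ‖Y‖² Y_k and Y_k. With γ = (2q +
1)/(2q + 4), the difference γD - N is exactly the sample mean of a centred function of ‖Y‖² plus
terms that each contain two centred sample means as factors
(`gaussianShape_mul_shapeDenominator_sub`). Such terms are of order 1/n in probability and vanish at
scale √n (`tendstoInMeasure_shape_remainder`).

The linear part obeys the central limit theorem with variance 8q(q - 1)²/(q + 2), and D tends almost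
surely to 4q(q + 2). Slutsky's lemma for γ - N/D = (γD - N)/D gives variance (q - 1)²/(2q(q + 2)³)
(`tendstoInDistribution_shape`). For q = 1 the linear part is zero, whence the point mass. -/

open scoped Topology ENNReal NNReal

/-! ### Functions with finite moments -/

/-- All moments of `f` under `ν` are finite. -/
def HasFiniteMoments {α : Type*} {_ : MeasurableSpace α} (f : α → ℝ) (ν : Measure α) : Prop :=
  ∀ p : ℝ≥0∞, p ≠ ∞ → MemLp f p ν

namespace HasFiniteMoments

variable {α : Type*} {_ : MeasurableSpace α} {ν : Measure α} {f g : α → ℝ}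

theorem memLp_two (hf : HasFiniteMoments f ν) : MemLp f 2 ν := hf 2 (by simp)

theorem integrable (hf : HasFiniteMoments f ν) : Integrable f ν :=
  memLp_one_iff_integrable.1 (hf 1 (by simp))

theorem add (hf : HasFiniteMoments f ν) (hg : HasFiniteMoments g ν) :
    HasFiniteMoments (fun x => f x + g x) ν := fun p hp => (hf p hp).add (hg p hp)

theorem sub (hf : HasFiniteMoments f ν) (hg : HasFiniteMoments g ν) :
    HasFiniteMoments (fun x => f x - g x) ν := fun p hp => (hf p hp).sub (hg p hp)

theorem const [IsFiniteMeasure ν] (c : ℝ) : HasFiniteMoments (fun _ => c) ν :=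
  fun _ _ => memLp_const c

/-- Hölder with exponents 2p, 2p, p. Closure under products is the reason for requiring every finite
exponent: integrability of all polynomials then comes for free. -/
theorem mul (hf : HasFiniteMoments f ν) (hg : HasFiniteMoments g ν) :
    HasFiniteMoments (fun x => f x * g x) ν := by
  intro p hp
  have h : ENNReal.HolderTriple (2 * p) (2 * p) p := ⟨by
    rw [ENNReal.mul_inv (by simp) (by simp), ← add_mul, ENNReal.inv_two_add_inv_two, one_mul]⟩
  have hp2 : 2 * p ≠ ∞ := ENNReal.mul_ne_top (by simp) hp
  exact (hg _ hp2).mul (hf _ hp2)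

theorem const_mul [IsFiniteMeasure ν] (c : ℝ) (hf : HasFiniteMoments f ν) :
    HasFiniteMoments (fun x => c * f x) ν := (const c).mul hf

theorem pow [IsFiniteMeasure ν] (hf : HasFiniteMoments f ν) (n : ℕ) :
    HasFiniteMoments (fun x => f x ^ n) ν := by
  induction n with
  | zero => simpa using const 1
  | succ n ih => simpa [pow_succ] using ih.mul hf

theorem sum [IsFiniteMeasure ν] {κ : Type*} (s : Finset κ) {f : κ → α → ℝ}
    (hf : ∀ k ∈ s, HasFiniteMoments (f k) ν) : HasFiniteMoments (fun x => ∑ k ∈ s, f k x) ν :=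
  fun p hp => memLp_finsetSum s fun k hk => hf k hk p hp

end HasFiniteMoments

/-! ### Moments of the standard normal distribution -/

theorem iteratedDeriv_charFun_gaussianReal (n : ℕ) :
    iteratedDeriv n (charFun (gaussianReal 0 1)) = fun t : ℝ =>
      (((-1) ^ n * Polynomial.aeval t (Polynomial.hermite n) * Real.exp (-(t ^ 2 / 2)) : ℝ) : ℂ) := by
  simp_rw [← Polynomial.deriv_gaussian_eq_hermite_mul_gaussian]
  induction n with
  | zero =>
    funext t
    simp [charFun_gaussianReal]
  | succ n ih =>
    rw [iteratedDeriv_succ, ih]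
    funext t
    rw [Function.iterate_succ_apply']
    refine HasDerivAt.deriv (HasDerivAt.ofReal_comp (DifferentiableAt.hasDerivAt ?_))
    have h : deriv^[n] (fun y => Real.exp (-(y ^ 2 / 2))) = fun x : ℝ =>
      (-1 : ℝ) ^ n * Polynomial.aeval x (Polynomial.hermite n) * Real.exp (-(x ^ 2 / 2)) :=
      funext (Polynomial.deriv_gaussian_eq_hermite_mul_gaussian n)
    rw [h]
    exact ((Polynomial.differentiableAt_aeval _).const_mul _).mul (by fun_prop)

-- Moments are read off from the derivatives of the characteristic function at 0. The sign (-1)^m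
-- occurs twice, in I^(2m) and in the constant coefficient of the Hermite polynomial, and cancels.
open scoped Nat in
theorem integral_pow_even_gaussianReal (m : ℕ) :
    ∫ x, x ^ (2 * m) ∂gaussianReal 0 1 = (((2 * m - 1)‼ : ℕ) : ℝ) := by
  have h1 := iteratedDeriv_charFun_zero (μ := gaussianReal 0 1) (n := 2 * m)
    (memLp_id_gaussianReal' _ (ENNReal.natCast_ne_top (2 * m)))
  rw [iteratedDeriv_charFun_gaussianReal] at h1
  have h2 := Polynomial.coeff_hermite_explicit m 0
  simp only [add_zero, Nat.choose_zero_right, Nat.cast_one, mul_one] at h2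
  have h3 : Polynomial.aeval (0 : ℝ) (Polynomial.hermite (2 * m)) =
      (-1) ^ m * (((2 * m - 1)‼ : ℕ) : ℝ) := by
    rw [← Polynomial.coeff_zero_eq_aeval_zero', h2]
    simp
  simp only [h3, pow_mul, Complex.I_sq, even_two, Even.neg_pow, one_pow, one_mul] at h1
  have h4 : ((-1 : ℂ) ^ m) * ((-1 : ℂ) ^ m) = 1 := by rw [← mul_pow]; simp
  have h5 := congrArg (fun z => (-1 : ℂ) ^ m * z) h1
  simp only [← mul_assoc, h4, one_mul] at h5
  push_cast at h5
  simp only [← mul_assoc, h4, one_mul] at h5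
  norm_num at h5
  have h6 : ((((2 * m - 1)‼ : ℕ) : ℝ) : ℂ) = ((∫ x, (x ^ 2) ^ m ∂gaussianReal 0 1 : ℝ) : ℂ) := by
    exact_mod_cast h5
  simp_rw [pow_mul]
  exact (Complex.ofReal_injective h6).symm

/-! ### Moments of standard Gaussian vectors -/

/-- The standard Gaussian distribution on `ι → ℝ`. -/
noncomputable abbrev gaussianPi (ι : Type*) [Fintype ι] : Measure (ι → ℝ) :=
  Measure.pi fun _ : ι => gaussianReal 0 1

section gaussianPi

variable {ι : Type*} [Fintype ι]

theorem hasFiniteMoments_eval (k : ι) : HasFiniteMoments (fun y : ι → ℝ => y k) (gaussianPi ι) :=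
  fun p hp => (memLp_id_gaussianReal' p hp).comp_measurePreserving
    (measurePreserving_eval (fun _ : ι => gaussianReal 0 1) k)

theorem hasFiniteMoments_sqNorm (s : Finset ι) :
    HasFiniteMoments (fun y : ι → ℝ => ∑ k ∈ s, y k ^ 2) (gaussianPi ι) :=
  .sum s fun k _ => (hasFiniteMoments_eval k).pow 2

theorem iIndepFun_eval_gaussianPi :
    iIndepFun (fun (k : ι) (y : ι → ℝ) => y k) (gaussianPi ι) :=
  iIndepFun_pi (X := fun _ => id) fun _ => aemeasurable_id

theorem integral_eval_pow_gaussianPi (k : ι) (n : ℕ) :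
    ∫ y, y k ^ n ∂gaussianPi ι = ∫ x, x ^ n ∂gaussianReal 0 1 :=
  integral_comp_eval (μ := fun _ : ι => gaussianReal 0 1) (f := fun x : ℝ => x ^ n) (by fun_prop)

theorem map_neg_gaussianPi : (gaussianPi ι).map (fun y => -y) = gaussianPi ι := by
  have h := Measure.pi_map_pi (μ := fun _ : ι => gaussianReal 0 1) (f := fun _ x => -x)
    (fun _ => by fun_prop)
  simp only [gaussianReal_map_neg, neg_zero] at h
  exact h

/-- Symmetry of the Gaussian under negation. The change of variables needs no integrability. -/
theorem integral_eq_zero_of_odd {f : (ι → ℝ) → ℝ} (hf : Measurable f) (hodd : ∀ y, f (-y) = -f y) :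
    ∫ y, f y ∂gaussianPi ι = 0 := by
  have h : ∫ y, f y ∂gaussianPi ι = ∫ y, f (-y) ∂gaussianPi ι := by
    conv_lhs => rw [← map_neg_gaussianPi]
    exact integral_map (by fun_prop) hf.aestronglyMeasurable
  simp only [hodd, integral_neg] at h
  linarith

theorem integral_eval_mul_eval_gaussianPi [DecidableEq ι] (k l : ι) :
    ∫ y, y k * y l ∂gaussianPi ι = if k = l then 1 else 0 := by
  split_ifs with h
  · subst h
    simp_rw [← pow_two, integral_eval_pow_gaussianPi]
    simpa using integral_pow_even_gaussianReal 1
  · have h1 := (iIndepFun_eval_gaussianPi.indepFun h).integral_fun_mul_eq_mul_integral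
      (hasFiniteMoments_eval k).integrable.aestronglyMeasurable
      (hasFiniteMoments_eval l).integrable.aestronglyMeasurable
    rw [h1, integral_eq_zero_of_odd (by fun_prop) (fun y => rfl), zero_mul]

theorem integral_sqNorm_insert [DecidableEq ι] {a : ι} {s : Finset ι} (ha : a ∉ s) (m n : ℕ) :
    ∫ y, (∑ k ∈ s, y k ^ 2) ^ m * (y a ^ 2) ^ n ∂gaussianPi ι =
      (∫ y, (∑ k ∈ s, y k ^ 2) ^ m ∂gaussianPi ι) * ∫ x, x ^ (2 * n) ∂gaussianReal 0 1 := by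
  have h := iIndepFun_eval_gaussianPi.indepFun_finset s {a} (by simpa using ha)
    (fun k => measurable_pi_apply k) (μ := gaussianPi ι)
  have h1 : IndepFun (fun y : ι → ℝ => (∑ k ∈ s, y k ^ 2) ^ m) (fun y => (y a ^ 2) ^ n)
      (gaussianPi ι) := by
    have h2 := h.comp (φ := fun z : s → ℝ => (∑ k, z k ^ 2) ^ m)
      (ψ := fun z : ({a} : Finset ι) → ℝ => (z ⟨a, by simp⟩ ^ 2) ^ n) (by fun_prop) (by fun_prop)
    convert h2 using 1
    · funext y
      simp only [Function.comp_apply]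
      rw [← Finset.sum_coe_sort]
    · rfl
  rw [h1.integral_fun_mul_eq_mul_integral
    ((hasFiniteMoments_sqNorm s).pow m).integrable.aestronglyMeasurable
    (((hasFiniteMoments_eval a).pow 2).pow n).integrable.aestronglyMeasurable]
  simp_rw [← pow_mul, integral_eval_pow_gaussianPi]

theorem integral_sqNorm_pow_insert [DecidableEq ι] {a : ι} {s : Finset ι} (ha : a ∉ s) (m : ℕ) :
    ∫ y, (∑ k ∈ insert a s, y k ^ 2) ^ m ∂gaussianPi ι =
      ∑ i ∈ Finset.range (m + 1), (∫ y, (∑ k ∈ s, y k ^ 2) ^ i ∂gaussianPi ι) *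
        (∫ x, x ^ (2 * (m - i)) ∂gaussianReal 0 1) * m.choose i := by
  simp_rw [Finset.sum_insert ha, add_comm (_ ^ 2) (Finset.sum _ _), add_pow]
  rw [integral_finsetSum _ fun i _ => (((hasFiniteMoments_sqNorm s).pow i).mul
    (((hasFiniteMoments_eval a).pow 2).pow (m - i))).mul (.const _) |>.integrable]
  simp_rw [integral_mul_const, integral_sqNorm_insert ha]

/-- Chi-square moments, by adding one coordinate at a time. The four orders are proved together
because the binomial expansion of each involves all lower ones. Order four is needed for the
variance of a quadratic in ‖y‖². -/
theorem integral_sqNorm_pow (s : Finset ι) :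
    ∫ y, (∑ k ∈ s, y k ^ 2) ^ 1 ∂gaussianPi ι = s.card ∧
    ∫ y, (∑ k ∈ s, y k ^ 2) ^ 2 ∂gaussianPi ι = s.card * (s.card + 2) ∧
    ∫ y, (∑ k ∈ s, y k ^ 2) ^ 3 ∂gaussianPi ι = s.card * (s.card + 2) * (s.card + 4) ∧
    ∫ y, (∑ k ∈ s, y k ^ 2) ^ 4 ∂gaussianPi ι =
      s.card * (s.card + 2) * (s.card + 4) * (s.card + 6) := by
  classical
  induction s using Finset.induction_on with
  | empty => simp
  | insert a s ha ih =>
    obtain ⟨h1, h2, h3, h4⟩ := ih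
    have g1 := integral_pow_even_gaussianReal 1
    have g2 := integral_pow_even_gaussianReal 2
    have g3 := integral_pow_even_gaussianReal 3
    have g4 := integral_pow_even_gaussianReal 4
    norm_num [Nat.doubleFactorial] at g1 g2 g3 g4
    simp only [integral_sqNorm_pow_insert ha, Finset.sum_range_succ, Finset.range_zero,
      Finset.sum_empty, h1, h2, h3, h4, Finset.card_insert_of_notMem ha, pow_zero, integral_const,
      probReal_univ, Nat.sub_self, Nat.reduceSub, Nat.reduceMul, Nat.reduceAdd, g1, g2, g3, g4,
      mul_zero, Nat.choose, smul_eq_mul]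
    push_cast
    refine ⟨?_, ?_, ?_, ?_⟩ <;> ring

end gaussianPi

/-! ### Sample averages and convergence in probability -/

/-- The sample mean `n⁻¹ ∑ f i` of the first `n` terms of a sequence. -/
noncomputable def sampleMean (n : ℕ) (f : ℕ → ℝ) : ℝ := (∑ i ∈ Finset.range n, f i) / n

/-- The average of a function over the first `n` terms of a random sample. -/
noncomputable def sampleAverage {Ω 𝓨 : Type*} (Y : ℕ → Ω → 𝓨) (f : 𝓨 → ℝ) (n : ℕ) (ω : Ω) : ℝ :=
  sampleMean n fun i => f (Y i ω)

section TendstoInMeasure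

variable {Ω : Type*} [MeasurableSpace Ω] {Pr : Measure Ω} [IsFiniteMeasure Pr]

/-- Convergence in measure means that every subsequence has an almost surely convergent further
subsequence; extracting twice serves both summands. -/
theorem tendstoInMeasure_zero_add {R S : ℕ → Ω → ℝ} (hRm : ∀ n, AEMeasurable (R n) Pr)
    (hSm : ∀ n, AEMeasurable (S n) Pr)
    (hR : TendstoInMeasure Pr R atTop fun _ => 0) (hS : TendstoInMeasure Pr S atTop fun _ => 0) :
    TendstoInMeasure Pr (fun n ω => R n ω + S n ω) atTop fun _ => 0 := by
  have hm : ∀ n, AEStronglyMeasurable (fun ω => R n ω + S n ω) Pr :=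
    fun n => ((hRm n).add (hSm n)).aestronglyMeasurable
  refine (exists_seq_tendstoInMeasure_atTop_iff hm).2 fun ns hns => ?_
  obtain ⟨a, ha, ha'⟩ := (hR.comp hns.tendsto_atTop).exists_seq_tendsto_ae
  obtain ⟨b, hb, hb'⟩ :=
    (hS.comp (hns.tendsto_atTop.comp ha.tendsto_atTop)).exists_seq_tendsto_ae
  refine ⟨a ∘ b, ha.comp hb, ?_⟩
  filter_upwards [ha', hb'] with ω h1 h2
  simpa using (h1.comp hb.tendsto_atTop).add h2

theorem tendstoInMeasure_zero_mul {R S : ℕ → Ω → ℝ} {s : ℝ} (hRm : ∀ n, AEMeasurable (R n) Pr)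
    (hSm : ∀ n, AEMeasurable (S n) Pr) (hR : TendstoInMeasure Pr R atTop fun _ => 0)
    (hS : ∀ᵐ ω ∂Pr, Tendsto (fun n => S n ω) atTop (𝓝 s)) :
    TendstoInMeasure Pr (fun n ω => R n ω * S n ω) atTop fun _ => 0 := by
  have hm : ∀ n, AEStronglyMeasurable (fun ω => R n ω * S n ω) Pr :=
    fun n => ((hRm n).mul (hSm n)).aestronglyMeasurable
  refine (exists_seq_tendstoInMeasure_atTop_iff hm).2 fun ns hns => ?_
  obtain ⟨a, ha, ha'⟩ := (hR.comp hns.tendsto_atTop).exists_seq_tendsto_ae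
  refine ⟨a, ha, ?_⟩
  filter_upwards [ha', hS] with ω h1 h2
  simpa using h1.mul (h2.comp (hns.tendsto_atTop.comp ha.tendsto_atTop))

theorem tendstoInMeasure_zero_sum {κ : Type*} (s : Finset κ) {R : κ → ℕ → Ω → ℝ}
    (hRm : ∀ k n, AEMeasurable (R k n) Pr)
    (hR : ∀ k ∈ s, TendstoInMeasure Pr (R k) atTop fun _ => 0) :
    TendstoInMeasure Pr (fun n ω => ∑ k ∈ s, R k n ω) atTop fun _ => 0 := by
  classical
  induction s using Finset.induction_on with
  | empty =>
    refine tendstoInMeasure_of_tendsto_ae (fun n => by fun_prop) (ae_of_all _ fun ω => ?_)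
    simp
  | insert a s ha ih =>
    simp_rw [Finset.sum_insert ha]
    exact tendstoInMeasure_zero_add (hRm a) (fun n => by fun_prop)
      (hR a (Finset.mem_insert_self a s)) (ih fun k hk => hR k (Finset.mem_insert_of_mem hk))

end TendstoInMeasure

/-! ### Limit theorems for functions of a random sample -/

section sample

variable {Ω 𝓨 : Type*} [MeasurableSpace Ω] [MeasurableSpace 𝓨] {Pr : Measure Ω}
  {ν : Measure 𝓨} {Y : ℕ → Ω → 𝓨} {f g : 𝓨 → ℝ}

theorem identDistrib_comp (hY : ∀ i, HasLaw (Y i) ν Pr) (hf : Measurable f) (i : ℕ) :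
    IdentDistrib (fun ω => f (Y i ω)) (fun ω => f (Y 0 ω)) Pr Pr :=
  IdentDistrib.comp ⟨(hY i).aemeasurable, (hY 0).aemeasurable,
    (hY i).map_eq.trans (hY 0).map_eq.symm⟩ hf

theorem memLp_comp (hY : ∀ i, HasLaw (Y i) ν Pr) {p : ℝ≥0∞} (hf : MemLp f p ν) (i : ℕ) :
    MemLp (fun ω => f (Y i ω)) p Pr := by
  rw [← (hY i).map_eq] at hf
  exact hf.comp_of_map (hY i).aemeasurable

theorem aemeasurable_sampleAverage (hY : ∀ i, HasLaw (Y i) ν Pr) (hf : Measurable f) (n : ℕ) :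
    AEMeasurable (fun ω => sampleAverage Y f n ω) Pr :=
  (Finset.aemeasurable_fun_sum _ fun i _ => hf.comp_aemeasurable (hY i).aemeasurable).div_const _

/-- Strong law of large numbers for functions of a random sample. -/
theorem tendsto_sampleAverage_ae (hY : ∀ i, HasLaw (Y i) ν Pr) (hindep : iIndepFun Y Pr)
    (hf : Measurable f) (hint : Integrable f ν) :
    ∀ᵐ ω ∂Pr, Tendsto (fun n => sampleAverage Y f n ω) atTop (𝓝 (∫ y, f y ∂ν)) := by
  have h := strong_law_ae_real (fun i ω => f (Y i ω)) (memLp_one_iff_integrable.1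
    (memLp_comp hY (memLp_one_iff_integrable.2 hint) 0))
    (fun i j hij => (hindep.indepFun hij).comp hf hf) (identDistrib_comp hY hf)
  have h0 := (hY 0).integral_comp (f := f) hf.aestronglyMeasurable
  simp only [Function.comp_def] at h0
  rwa [h0] at h

theorem memLp_sampleAverage (hY : ∀ i, HasLaw (Y i) ν Pr) (hf : MemLp f 2 ν) (n : ℕ) :
    MemLp (fun ω => sampleAverage Y f n ω) 2 Pr := by
  simp_rw [sampleAverage, sampleMean, div_eq_mul_inv]
  exact (memLp_finsetSum _ fun i _ => memLp_comp hY hf i).mul_const _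

variable [IsProbabilityMeasure Pr]

theorem integral_sampleAverage_sq (hY : ∀ i, HasLaw (Y i) ν Pr) (hindep : iIndepFun Y Pr)
    (hf : Measurable f) (hf2 : MemLp f 2 ν) (hf0 : ∫ y, f y ∂ν = 0) (n : ℕ) :
    ∫ ω, sampleAverage Y f n ω ^ 2 ∂Pr = (n : ℝ)⁻¹ * ∫ y, f y ^ 2 ∂ν := by
  have hm : ∀ i, ∫ ω, f (Y i ω) ∂Pr = 0 := fun i =>
    ((hY i).integral_comp (f := f) hf.aestronglyMeasurable).trans hf0
  have hi : ∀ i, Integrable (fun ω => f (Y i ω)) Pr := fun i =>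
    (memLp_comp hY hf2 i).integrable (by simp)
  have h1 := IndepFun.variance_sum (μ := Pr) (X := fun i ω => f (Y i ω)) (s := Finset.range n)
    (fun i _ => memLp_comp hY hf2 i) (fun i _ j _ hij => (hindep.indepFun hij).comp hf hf)
  have h2 : ∀ i, variance (fun ω => f (Y i ω)) Pr = ∫ y, f y ^ 2 ∂ν := fun i => by
    rw [variance_of_integral_eq_zero (memLp_comp hY hf2 i).aestronglyMeasurable.aemeasurable (hm i)]
    exact (hY i).integral_comp (f := fun y => f y ^ 2) (hf.pow_const 2).aestronglyMeasurable
  have h3 : ∫ ω, (∑ i ∈ Finset.range n, fun ω => f (Y i ω)) ω ∂Pr = 0 := by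
    simp_rw [Finset.sum_apply]
    rw [integral_finsetSum _ fun i _ => hi i]
    simp [hm]
  rw [variance_of_integral_eq_zero (memLp_finsetSum' _ fun i _ =>
    memLp_comp hY hf2 i).aestronglyMeasurable.aemeasurable h3] at h1
  simp only [Finset.sum_apply, h2, Finset.sum_const, Finset.card_range, nsmul_eq_mul] at h1
  simp_rw [sampleAverage, sampleMean, div_pow]
  rw [integral_div, h1]
  rcases eq_or_ne n 0 with rfl | hn
  · simp
  · field_simp

/-- The product of two centred sample means is negligible at the scale `n ^ (-1/2)`. -/
theorem tendstoInMeasure_sqrt_mul_sampleAverage_mul (hY : ∀ i, HasLaw (Y i) ν Pr)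
    (hindep : iIndepFun Y Pr) (hf : Measurable f) (hf2 : MemLp f 2 ν) (hf0 : ∫ y, f y ∂ν = 0)
    (hg : Measurable g) (hg2 : MemLp g 2 ν) (hg0 : ∫ y, g y ∂ν = 0) :
    TendstoInMeasure Pr (fun (n : ℕ) ω => √(n : ℝ) * (sampleAverage Y f n ω *
      sampleAverage Y g n ω)) atTop fun _ => 0 := by
  have hfn := memLp_sampleAverage hY hf2
  have hgn := memLp_sampleAverage hY hg2
  refine tendstoInMeasure_of_tendsto_eLpNorm one_ne_zero (fun n => ?_)
    aestronglyMeasurable_const ?_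
  · exact ((aemeasurable_sampleAverage hY hf n).mul
      (aemeasurable_sampleAverage hY hg n)).aestronglyMeasurable.const_mul _
  -- Since |ab| ≤ a² + b² and both second moments are of order 1/n, the L¹ norm is of order n ^
  -- (-1/2).
  have hbound : ∀ n : ℕ, eLpNorm ((fun ω => √(n : ℝ) * (sampleAverage Y f n ω *
      sampleAverage Y g n ω)) - fun _ => 0) 1 Pr ≤
      ENNReal.ofReal ((√(n : ℝ))⁻¹ * ((∫ y, f y ^ 2 ∂ν) + ∫ y, g y ^ 2 ∂ν)) := by
    intro n
    have hsum : ∫ ω, √(n : ℝ) * (sampleAverage Y f n ω ^ 2 +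
        sampleAverage Y g n ω ^ 2) ∂Pr =
        (√(n : ℝ))⁻¹ * ((∫ y, f y ^ 2 ∂ν) + ∫ y, g y ^ 2 ∂ν) := by
      rw [integral_const_mul, integral_add (hfn n).integrable_sq (hgn n).integrable_sq,
        integral_sampleAverage_sq hY hindep hf hf2 hf0, integral_sampleAverage_sq hY hindep hg hg2 hg0]
      rcases eq_or_ne n 0 with rfl | hn
      · simp
      have hn' : (0 : ℝ) < n := by positivity
      have hs := Real.sq_sqrt hn'.le
      have hs' : 0 < √(n : ℝ) := Real.sqrt_pos.2 hn'
      field_simp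
      rw [hs]
    have hint : Integrable (fun ω => √(n : ℝ) * (sampleAverage Y f n ω ^ 2 +
        sampleAverage Y g n ω ^ 2)) Pr :=
      ((hfn n).integrable_sq.add (hgn n).integrable_sq).const_mul _
    rw [eLpNorm_one_eq_lintegral_enorm, ← hsum, ofReal_integral_eq_lintegral_ofReal hint
      (ae_of_all _ fun ω => mul_nonneg (Real.sqrt_nonneg _) (by positivity))]
    refine lintegral_mono fun ω => ?_
    simp only [Pi.sub_apply, sub_zero]
    rw [Real.enorm_eq_ofReal_abs, abs_mul, abs_of_nonneg (Real.sqrt_nonneg _)]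
    refine ENNReal.ofReal_le_ofReal (mul_le_mul_of_nonneg_left ?_ (Real.sqrt_nonneg _))
    rw [abs_le]
    constructor <;>
      nlinarith [sq_nonneg (sampleAverage Y f n ω - sampleAverage Y g n ω),
        sq_nonneg (sampleAverage Y f n ω + sampleAverage Y g n ω)]
  refine tendsto_of_tendsto_of_tendsto_of_le_of_le tendsto_const_nhds ?_ (fun _ => zero_le) hbound
  have h : Tendsto (fun n : ℕ => (√(n : ℝ))⁻¹ * ((∫ y, f y ^ 2 ∂ν) + ∫ y, g y ^ 2 ∂ν)) atTop
      (𝓝 (0 * ((∫ y, f y ^ 2 ∂ν) + ∫ y, g y ^ 2 ∂ν))) :=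
    Tendsto.mul_const _ (tendsto_inv_atTop_zero.comp
      (Real.tendsto_sqrt_atTop.comp tendsto_natCast_atTop_atTop))
  rw [zero_mul] at h
  simpa using ENNReal.tendsto_ofReal h

/-- Central limit theorem for centred functions of a random sample. -/
theorem tendstoInDistribution_sqrt_mul_sampleAverage (hY : ∀ i, HasLaw (Y i) ν Pr)
    (hindep : iIndepFun Y Pr) (hf : Measurable f) (hf2 : MemLp f 2 ν) (hf0 : ∫ y, f y ∂ν = 0) :
    TendstoInDistribution (fun (n : ℕ) ω => √(n : ℝ) * sampleAverage Y f n ω) atTop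
      (id : ℝ → ℝ) (fun _ => Pr) (gaussianReal 0 (∫ y, f y ^ 2 ∂ν).toNNReal) := by
  have hm : ∫ ω, f (Y 0 ω) ∂Pr = 0 :=
    ((hY 0).integral_comp (f := f) hf.aestronglyMeasurable).trans hf0
  have hv : variance (fun ω => f (Y 0 ω)) Pr = ∫ y, f y ^ 2 ∂ν := by
    rw [variance_of_integral_eq_zero (memLp_comp hY hf2 0).aestronglyMeasurable.aemeasurable hm]
    exact (hY 0).integral_comp (f := fun y => f y ^ 2) (hf.pow_const 2).aestronglyMeasurable
  have h := tendstoInDistribution_inv_sqrt_mul_sum_sub (P := Pr)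
    (P' := gaussianReal 0 (∫ y, f y ^ 2 ∂ν).toNNReal) (X := fun i ω => f (Y i ω)) (Y := id)
    (by rw [hv]; exact HasLaw.id) (memLp_comp hY hf2 0) (hindep.comp (fun _ => f) fun _ => hf)
    (identDistrib_comp hY hf)
  convert! h using 3 with n ω
  rw [hm, mul_zero, sub_zero, sampleAverage, sampleMean]
  rcases eq_or_ne n 0 with rfl | hn
  · simp
  have hn' : (0 : ℝ) < n := by positivity
  have hs := Real.sq_sqrt hn'.le
  have hs' : 0 < √(n : ℝ) := Real.sqrt_pos.2 hn'
  field_simp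
  rw [hs, mul_comm]

end sample

/-! ### Algebra of sample means -/

section sampleMean

variable {n : ℕ}

theorem sampleMean_add (f g : ℕ → ℝ) :
    (sampleMean n fun i => f i + g i) = sampleMean n f + sampleMean n g := by
  simp only [sampleMean, Finset.sum_add_distrib, add_div]

theorem sampleMean_sub (f g : ℕ → ℝ) :
    (sampleMean n fun i => f i - g i) = sampleMean n f - sampleMean n g := by
  simp only [sampleMean, Finset.sum_sub_distrib, sub_div]

theorem sampleMean_const_mul (c : ℝ) (f : ℕ → ℝ) :
    (sampleMean n fun i => c * f i) = c * sampleMean n f := by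
  simp only [sampleMean, ← Finset.mul_sum, mul_div_assoc]

theorem sampleMean_mul_const (c : ℝ) (f : ℕ → ℝ) :
    (sampleMean n fun i => f i * c) = sampleMean n f * c := by
  simp only [mul_comm _ c, sampleMean_const_mul]

theorem sampleMean_sum {κ : Type*} (s : Finset κ) (f : κ → ℕ → ℝ) :
    (sampleMean n fun i => ∑ k ∈ s, f k i) = ∑ k ∈ s, sampleMean n (f k) := by
  simp only [sampleMean, Finset.sum_div]
  rw [Finset.sum_comm]

theorem sampleMean_const (hn : n ≠ 0) (c : ℝ) : (sampleMean n fun _ => c) = c := by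
  simp [sampleMean, hn]

end sampleMean

/-! ### Object shape of an empirical distribution -/

section empirical

theorem integral_smul_count_fin (n : ℕ) (g : ℕ → ℝ) :
    ∫ i : Fin n, g i ∂((n : ℝ≥0∞)⁻¹ • Measure.count) = sampleMean n g := by
  rw [integral_smul_measure, integral_fintype Integrable.of_finite]
  simp [sampleMean, Finset.sum_range, div_eq_inv_mul]

variable {𝓧 : Type*} [MeasurableSpace 𝓧]

/-- As a pushforward from a finite discrete space, the empirical measure allows Fubini without any
integrability condition. -/
theorem empiricalDistribution_eq_map (n : ℕ) (x : ℕ → 𝓧) :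
    empiricalDistribution n x =
      ((n : ℝ≥0∞)⁻¹ • Measure.count : Measure (Fin n)).map fun i : Fin n => x i := by
  have hx : Measurable fun i : Fin n => x i := measurable_of_countable _
  ext s hs
  rw [Measure.map_apply hx hs, empiricalDistribution, Measure.smul_apply, Measure.smul_apply,
    Measure.finsetSum_apply, Measure.count, Measure.sum_apply _ (hx hs), tsum_fintype,
    Finset.sum_range]
  congr 1
  refine Finset.sum_congr rfl fun i _ => ?_
  rw [Measure.dirac_apply' _ hs, Measure.dirac_apply' _ (hx hs)]
  rfl

theorem integral_empiricalDistribution_prod {n : ℕ} (hn : n ≠ 0) (x : ℕ → 𝓧) {f : 𝓧 × 𝓧 → ℝ}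
    (hf : Measurable f) :
    ∫ z, f z ∂((empiricalDistribution n x).prod (empiricalDistribution n x)) =
      sampleMean n fun i => sampleMean n fun j => f (x i, x j) := by
  have hx : Measurable fun i : Fin n => x i := measurable_of_countable _
  have : IsFiniteMeasure ((n : ℝ≥0∞)⁻¹ • Measure.count : Measure (Fin n)) :=
    Measure.smul_finite _ (by simp [hn])
  rw [empiricalDistribution_eq_map, Measure.map_prod_map _ _ hx hx,
    integral_map (by fun_prop) hf.aestronglyMeasurable, integral_prod _ Integrable.of_finite]
  simp only [Prod.map_apply]
  simp_rw [fun i => integral_smul_count_fin n fun j => f (x i, x j)]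
  exact integral_smul_count_fin n fun i => sampleMean n fun j => f (x i, x j)

theorem integral_empiricalDistribution_prod_prod {n : ℕ} (hn : n ≠ 0) (x : ℕ → 𝓧)
    {f : 𝓧 × 𝓧 × 𝓧 → ℝ} (hf : Measurable f) :
    ∫ z, f z ∂((empiricalDistribution n x).prod
        ((empiricalDistribution n x).prod (empiricalDistribution n x))) =
      sampleMean n fun i => sampleMean n fun j => sampleMean n fun k => f (x i, x j, x k) := by
  have hx : Measurable fun i : Fin n => x i := measurable_of_countable _
  have : IsFiniteMeasure ((n : ℝ≥0∞)⁻¹ • Measure.count : Measure (Fin n)) :=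
    Measure.smul_finite _ (by simp [hn])
  rw [empiricalDistribution_eq_map, Measure.map_prod_map _ _ hx hx,
    Measure.map_prod_map _ _ hx (hx.prodMap hx),
    integral_map (by fun_prop) hf.aestronglyMeasurable, integral_prod _ Integrable.of_finite]
  simp_rw [integral_prod _ Integrable.of_finite]
  simp only [Prod.map_apply]
  simp_rw [fun i j => integral_smul_count_fin n fun k => f (x i, x j, x k),
    fun i => integral_smul_count_fin n fun j => sampleMean n fun k => f (x i, x j, x k)]
  exact integral_smul_count_fin n fun i => sampleMean n fun j => sampleMean n fun k =>
    f (x i, x j, x k)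

/-- For fixed i the averages over the second and third draws separate and coincide, so the triple
sum becomes a mean of squares. -/
theorem objectShape_empiricalDistribution {𝓧 : Type*} [MetricSpace 𝓧] [MeasurableSpace 𝓧]
    (hd : Measurable fun z : 𝓧 × 𝓧 => dist z.1 z.2) {n : ℕ} (hn : n ≠ 0) (x : ℕ → 𝓧) :
    objectShape (empiricalDistribution n x) =
      (sampleMean n fun i => (sampleMean n fun j => dist (x i) (x j) ^ 2) ^ 2) /
        sampleMean n fun i => sampleMean n fun j => dist (x i) (x j) ^ 4 := by
  have h2 : Measurable fun z : 𝓧 × 𝓧 × 𝓧 => dist z.1 z.2.1 ^ 2 * dist z.1 z.2.2 ^ 2 :=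
    ((hd.comp (measurable_fst.prodMk measurable_snd.fst)).pow_const 2).mul
      ((hd.comp (measurable_fst.prodMk measurable_snd.snd)).pow_const 2)
  rw [objectShape, integral_empiricalDistribution_prod hn x (hd.pow_const 4),
    integral_empiricalDistribution_prod_prod hn x h2]
  simp only [sampleMean_const_mul, sampleMean_mul_const, pow_two (sampleMean n _)]

end empirical

/-! ### Expansion of the shape in sample moments -/

section algebra

variable {ι : Type*} [Fintype ι]

theorem sum_sub_sq_eq (u v : ι → ℝ) :
    ∑ k, (u k - v k) ^ 2 = ∑ k, u k ^ 2 + ∑ k, v k ^ 2 - 2 * ∑ k, u k * v k := by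
  rw [Finset.mul_sum, ← Finset.sum_add_distrib, ← Finset.sum_sub_distrib]
  exact Finset.sum_congr rfl fun k _ => by ring

variable {n : ℕ} (y : ℕ → ι → ℝ)

theorem sampleMean_sum_mul_sq (u : ι → ℝ) :
    (sampleMean n fun i => (∑ k, y i k * u k) ^ 2) =
      ∑ k, ∑ l, u k * u l * sampleMean n fun i => y i k * y i l := by
  simp_rw [← sampleMean_const_mul, ← sampleMean_sum, pow_two, Finset.sum_mul_sum]
  congr 1
  funext i
  exact Finset.sum_congr rfl fun k _ => Finset.sum_congr rfl fun l _ => by ring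

theorem sampleMean_sum_mul (u : ι → ℝ) :
    (sampleMean n fun i => ∑ k, y i k * u k) = ∑ k, u k * sampleMean n fun i => y i k := by
  simp_rw [sampleMean_sum, sampleMean_mul_const, mul_comm]

theorem sampleMean_mul_sum_mul (r : ℕ → ℝ) (u : ι → ℝ) :
    (sampleMean n fun i => r i * ∑ k, y i k * u k) =
      ∑ k, u k * sampleMean n fun i => r i * y i k := by
  simp_rw [← sampleMean_const_mul, ← sampleMean_sum, Finset.mul_sum]
  congr 1
  funext i
  exact Finset.sum_congr rfl fun k _ => by ring

/-- Expand (‖u‖² + ‖v‖² - 2⟨u, v⟩)² and average over both points. The square of the inner product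
yields the squared entries of the second moment matrix. -/
theorem sampleMean_sampleMean_sqDist_sq (hn : n ≠ 0) :
    (sampleMean n fun i => sampleMean n fun j => (∑ k, (y i k - y j k) ^ 2) ^ 2) =
      2 * (sampleMean n fun i => (∑ k, y i k ^ 2) ^ 2) +
      2 * (sampleMean n fun i => ∑ k, y i k ^ 2) ^ 2 +
      4 * (∑ k, ∑ l, (sampleMean n fun i => y i k * y i l) ^ 2) -
      8 * ∑ k, (sampleMean n fun i => (∑ l, y i l ^ 2) * y i k) * sampleMean n fun i => y i k := by
  have h1 : ∀ i j, (∑ k, (y i k - y j k) ^ 2) ^ 2 =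
      (∑ k, y i k ^ 2) ^ 2 + (∑ k, y j k ^ 2) ^ 2 + (2 * ∑ k, y i k ^ 2) * (∑ k, y j k ^ 2) +
      4 * (∑ k, y j k * y i k) ^ 2 - (4 * ∑ k, y i k ^ 2) * (∑ k, y j k * y i k) -
      4 * ((∑ k, y j k ^ 2) * ∑ k, y j k * y i k) := fun i j => by
    rw [sum_sub_sq_eq]
    simp_rw [mul_comm (y i _) (y j _)]
    ring
  have h2 : ∀ i, (sampleMean n fun j => (∑ k, (y i k - y j k) ^ 2) ^ 2) =
      (∑ k, y i k ^ 2) ^ 2 + (sampleMean n fun i => (∑ k, y i k ^ 2) ^ 2) +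
      2 * ((∑ k, y i k ^ 2) * sampleMean n fun i => ∑ k, y i k ^ 2) +
      4 * (∑ k, ∑ l, y i k * y i l * sampleMean n fun j => y j k * y j l) -
      4 * ((∑ k, y i k ^ 2) * ∑ k, y i k * sampleMean n fun j => y j k) -
      4 * ∑ k, y i k * sampleMean n fun j => (∑ l, y j l ^ 2) * y j k := fun i => by
    simp_rw [h1, sampleMean_sub, sampleMean_add, sampleMean_const hn, sampleMean_const_mul,
      sampleMean_sum_mul_sq, sampleMean_mul_sum_mul, sampleMean_sum_mul, mul_assoc]
  have h3 : (sampleMean n fun i => ∑ k, ∑ l, y i k * y i l * sampleMean n fun j => y j k * y j l) =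
      ∑ k, ∑ l, (sampleMean n fun i => y i k * y i l) ^ 2 := by
    simp_rw [sampleMean_sum]
    simp only [sampleMean_mul_const, pow_two]
  simp_rw [h2, sampleMean_sub, sampleMean_add, sampleMean_const hn, sampleMean_const_mul, h3,
    sampleMean_mul_sum_mul, sampleMean_mul_const, sampleMean_sum_mul,
    mul_comm (sampleMean n fun i => y i _)]
  ring

/-- The inner average over j is ‖y_i‖² + A - 2⟨y_i, b⟩, with b the mean vector and A the mean
squared norm; it is then squared and averaged over i. -/
theorem sampleMean_sampleMean_sqDist_pow_two (hn : n ≠ 0) :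
    (sampleMean n fun i => (sampleMean n fun j => ∑ k, (y i k - y j k) ^ 2) ^ 2) =
      (sampleMean n fun i => (∑ k, y i k ^ 2) ^ 2) +
      3 * (sampleMean n fun i => ∑ k, y i k ^ 2) ^ 2 -
      4 * (∑ k, (sampleMean n fun i => (∑ l, y i l ^ 2) * y i k) * sampleMean n fun i => y i k) +
      4 * (∑ k, ∑ l, (sampleMean n fun i => y i k) * (sampleMean n fun i => y i l) *
        sampleMean n fun i => y i k * y i l) -
      4 * (sampleMean n fun i => ∑ k, y i k ^ 2) * ∑ k, (sampleMean n fun i => y i k) ^ 2 := by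
  set b : ι → ℝ := fun k => sampleMean n fun i => y i k
  set A : ℝ := sampleMean n fun i => ∑ k, y i k ^ 2 with hA
  have h0 : ∀ i, (sampleMean n fun j => ∑ k, (y i k - y j k) ^ 2) =
      ∑ k, y i k ^ 2 + A - 2 * ∑ k, y i k * b k := fun i => by
    simp_rw [sum_sub_sq_eq, sampleMean_sub, sampleMean_add, sampleMean_const hn,
      sampleMean_const_mul, sampleMean_sum, sampleMean_const_mul]
    rw [hA, sampleMean_sum]
  have h1 : ∀ i, (∑ k, y i k ^ 2 + A - 2 * ∑ k, y i k * b k) ^ 2 =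
      (∑ k, y i k ^ 2) ^ 2 + A ^ 2 + 4 * (∑ k, y i k * b k) ^ 2 + 2 * A * (∑ k, y i k ^ 2) -
      4 * ((∑ k, y i k ^ 2) * ∑ k, y i k * b k) - 4 * A * (∑ k, y i k * b k) := fun i => by
    ring
  have hb' : ∀ k, (sampleMean n fun i => y i k) = b k := fun _ => rfl
  have h2 : (∑ k, b k * sampleMean n fun i => (∑ l, y i l ^ 2) * y i k) =
      ∑ k, (sampleMean n fun i => (∑ l, y i l ^ 2) * y i k) * b k :=
    Finset.sum_congr rfl fun k _ => mul_comm _ _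
  simp_rw [h0, h1, sampleMean_sub, sampleMean_add, sampleMean_const hn, sampleMean_const_mul,
    sampleMean_sum_mul_sq, sampleMean_mul_sum_mul, sampleMean_sum_mul, h2, ← hA, hb', ← pow_two]
  ring

end algebra

/-! ### Projection onto the hyperplane orthogonal to constants -/

section contrast

open scoped RealInnerProductSpace

/-- The adjoint of a linear isometry maps a standard Gaussian to a standard Gaussian. -/
theorem stdGaussian_map_adjoint {E E' : Type*} [NormedAddCommGroup E] [InnerProductSpace ℝ E]
    [FiniteDimensional ℝ E] [MeasurableSpace E] [BorelSpace E] [NormedAddCommGroup E']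
    [InnerProductSpace ℝ E'] [FiniteDimensional ℝ E'] [MeasurableSpace E'] [BorelSpace E']
    (L : E' →ₗᵢ[ℝ] E) :
    (stdGaussian E).map (L.toContinuousLinearMap.adjoint) = stdGaussian E' := by
  have := FiniteDimensional.complete ℝ E
  have := FiniteDimensional.complete ℝ E'
  have hm : Measurable (L.toContinuousLinearMap.adjoint) :=
    (L.toContinuousLinearMap.adjoint).continuous.measurable
  have : IsProbabilityMeasure ((stdGaussian E).map (L.toContinuousLinearMap.adjoint)) :=
    Measure.isProbabilityMeasure_map hm.aemeasurable
  refine Measure.ext_of_charFun (funext fun t => ?_)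
  rw [charFun_apply, integral_map hm.aemeasurable (by fun_prop), charFun_stdGaussian]
  -- The characteristic function of the image at t is that of the source at L t, and ‖L t‖ = ‖t‖.
  simp_rw [ContinuousLinearMap.adjoint_inner_left]
  rw [← charFun_apply, charFun_stdGaussian]
  simp

theorem sum_sum_sub_sq {p : ℕ} (v : Fin p → ℝ) :
    ∑ j, ∑ k, (v j - v k) ^ 2 = 2 * p * (∑ j, v j ^ 2) - 2 * (∑ j, v j) ^ 2 := by
  have h : ∀ j k, (v j - v k) ^ 2 = v j ^ 2 + v k ^ 2 - 2 * (v j * v k) := fun j k => by ring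
  simp_rw [h, Finset.sum_sub_distrib, Finset.sum_add_distrib, ← Finset.mul_sum, ← Finset.sum_mul]
  simp only [Finset.sum_const, Finset.card_univ, Fintype.card_fin, nsmul_eq_mul, ← Finset.mul_sum]
  ring

/-- Orthonormal coordinates of the hyperplane orthogonal to the constant vectors. -/
theorem exists_contrast_map {p : ℕ} (hp : 1 < p) :
    ∃ B : EuclideanSpace ℝ (Fin p) →L[ℝ] EuclideanSpace ℝ (Fin (p - 1)),
      B (WithLp.toLp 2 fun _ => 1) = 0 ∧
      (∀ v, ‖B v‖ ^ 2 = 1 / (2 * (p : ℝ)) * ∑ j, ∑ k, (v j - v k) ^ 2) ∧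
      (stdGaussian (EuclideanSpace ℝ (Fin p))).map B =
        stdGaussian (EuclideanSpace ℝ (Fin (p - 1))) := by
  have hp0 : (0 : ℝ) < p := by exact_mod_cast (by omega : 0 < p)
  set u : EuclideanSpace ℝ (Fin p) := WithLp.toLp 2 fun _ => 1 with hu
  have hun : ⟪u, u⟫ = p := by
    rw [real_inner_self_eq_norm_sq, EuclideanSpace.real_norm_sq_eq]
    simp [hu]
  have hu0 : u ≠ 0 := fun h => by simp [h] at hun; linarith
  let S : Submodule ℝ (EuclideanSpace ℝ (Fin p)) := (Submodule.span ℝ {u})ᗮ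
  have hdim : Module.finrank ℝ S = p - 1 := by
    have h1 := Submodule.finrank_add_finrank_orthogonal (Submodule.span ℝ {u})
    rw [finrank_span_singleton hu0, finrank_euclideanSpace_fin] at h1
    change Module.finrank ℝ (Submodule.span ℝ {u})ᗮ = _
    omega
  let b : OrthonormalBasis (Fin (p - 1)) ℝ S := (stdOrthonormalBasis ℝ S).reindex (finCongr hdim)
  -- `L` embeds ℝ^(p-1) isometrically onto the hyperplane `S`; its adjoint is the orthogonal
  -- projection onto `S` read in coordinates.
  let L : EuclideanSpace ℝ (Fin (p - 1)) →ₗᵢ[ℝ] EuclideanSpace ℝ (Fin p) :=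
    S.subtypeₗᵢ.comp b.repr.symm.toLinearIsometry
  have hL : ∀ w, L w ∈ S := fun w => (b.repr.symm w).2
  have hBu : L.toContinuousLinearMap.adjoint u = 0 := by
    refine ext_inner_right ℝ fun w => ?_
    rw [ContinuousLinearMap.adjoint_inner_left, inner_zero_left]
    exact Submodule.mem_orthogonal_singleton_iff_inner_right.1 (hL w)
  have hBL : ∀ w, L.toContinuousLinearMap.adjoint (L w) = w := fun w =>
    ext_inner_right ℝ fun w' => by
      rw [ContinuousLinearMap.adjoint_inner_left]
      exact L.inner_map_map w w'
  refine ⟨L.toContinuousLinearMap.adjoint, hBu, fun v => ?_, stdGaussian_map_adjoint L⟩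
  -- `c • u` is the component of `v` along `u`, so ‖B v‖² = ‖v - c • u‖².
  set c : ℝ := (∑ j, v j) / p with hc
  have huv : ⟪u, v⟫ = ∑ j, v j := by simp [hu, PiLp.inner_apply]
  have hmem : v - c • u ∈ S := by
    refine Submodule.mem_orthogonal_singleton_iff_inner_right.2 ?_
    rw [inner_sub_right, inner_smul_right, hun, huv, hc]
    field_simp
    ring
  have hw : L (b.repr ⟨v - c • u, hmem⟩) = v - c • u := by
    change ((b.repr.symm (b.repr ⟨v - c • u, hmem⟩) : S) : EuclideanSpace ℝ (Fin p)) = _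
    rw [LinearIsometryEquiv.symm_apply_apply]
  have hB : L.toContinuousLinearMap.adjoint v = b.repr ⟨v - c • u, hmem⟩ := by
    conv_lhs => rw [← sub_add_cancel v (c • u), ← hw]
    rw [map_add, map_smul, hBu, smul_zero, add_zero, hBL]
  rw [hB, ← L.norm_map, hw, norm_sub_sq_real, inner_smul_right, real_inner_comm, huv, norm_smul,
    mul_pow, ← real_inner_self_eq_norm_sq u, hun, sum_sum_sub_sq v.ofLp,
    EuclideanSpace.real_norm_sq_eq, hc, Real.norm_eq_abs, sq_abs]
  field_simp
  ring

end contrast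

/-! ### Gaussian coordinates on the simplex -/

namespace Simplex

variable {p : ℕ}

theorem measurable_coord (j : Fin p) : Measurable fun x : Simplex p => x j :=
  (measurable_pi_apply j).comp measurable_subtype_coe

theorem dist_sq (x y : Simplex p) : dist x y ^ 2 = 1 / (2 * (p : ℝ)) *
    ∑ j, ∑ k, ((Real.log (x j) - Real.log (y j)) - (Real.log (x k) - Real.log (y k))) ^ 2 := by
  change aitchisonDist x y ^ 2 = _
  rw [aitchisonDist, Real.sq_sqrt (by positivity)]
  congr 1
  refine Finset.sum_congr rfl fun j _ => Finset.sum_congr rfl fun k _ => ?_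
  rw [Real.log_div (x.2.1 j).1.ne' (x.2.1 k).1.ne', Real.log_div (y.2.1 j).1.ne' (y.2.1 k).1.ne']
  ring

/-- The σ-algebra is inherited from `Fin p → ℝ`, not defined from the Aitchison metric, so
measurability is taken from the explicit formula. -/
theorem measurable_dist : Measurable fun z : Simplex p × Simplex p => dist z.1 z.2 := by
  have h : (fun z : Simplex p × Simplex p => dist z.1 z.2) = fun z =>
      √((1 / (2 * (p : ℝ))) * ∑ j, ∑ k,
        (Real.log (z.1 j / z.1 k) - Real.log (z.2 j / z.2 k)) ^ 2) := rfl
  have h1 : ∀ j, Measurable fun z : Simplex p × Simplex p => z.1 j := fun j =>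
    (measurable_coord j).comp measurable_fst
  have h2 : ∀ j, Measurable fun z : Simplex p × Simplex p => z.2 j := fun j =>
    (measurable_coord j).comp measurable_snd
  rw [h]
  fun_prop

end Simplex

theorem log_randomComposition {p : ℕ} (hp : 1 < p) (μ θ : Fin p → ℝ) (hμ : ∀ j, 0 < μ j)
    (z : Fin p → Set.Ioi (0 : ℝ)) (j : Fin p) :
    Real.log (randomComposition hp μ θ hμ z j) = Real.log (μ j) + θ j * Real.log (z j) -
      Real.log (∑ k, μ k * (z k : ℝ) ^ θ k) := by
  have hz : ∀ k, 0 < μ k * (z k : ℝ) ^ θ k := fun k =>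
    mul_pos (hμ k) (Real.rpow_pos_of_pos (z k).2 _)
  have hs : 0 < ∑ k, μ k * (z k : ℝ) ^ θ k := Finset.sum_pos (fun k _ => hz k) ⟨j, by simp⟩
  change Real.log (μ j * (z j : ℝ) ^ θ j / ∑ k, μ k * (z k : ℝ) ^ θ k) = _
  rw [Real.log_div (hz j).ne' hs.ne', Real.log_mul (hμ j).ne'
    (Real.rpow_pos_of_pos (z j).2 _).ne', Real.log_rpow (z j).2]

/-- Log-normal compositions with equal scale parameters are, up to a similarity, standard Gaussian
vectors. -/
theorem exists_gaussian_coordinates {p : ℕ} (hp : 1 < p) (μ : Fin p → ℝ) (hμ : ∀ j, 0 < μ j)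
    {θ₀ : ℝ} (hθ₀ : 0 < θ₀) (F : Measure (Set.Ioi (0 : ℝ))) [IsProbabilityMeasure F]
    (hF : F.map (fun z : Set.Ioi (0 : ℝ) => Real.log (z : ℝ)) = gaussianReal 0 1) :
    ∃ Φ : Simplex p → Fin (p - 1) → ℝ, Measurable Φ ∧
      (∀ x y, dist x y ^ 2 = θ₀ ^ 2 * ∑ k, (Φ x k - Φ y k) ^ 2) ∧
      (compositionalDistribution hp F μ (fun _ => θ₀) hμ).map Φ = gaussianPi (Fin (p - 1)) := by
  obtain ⟨B, hBu, hBn, hBG⟩ := exists_contrast_map hp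
  let ψ : Simplex p → EuclideanSpace ℝ (Fin p) := fun x =>
    WithLp.toLp 2 fun j => Real.log (x j) - Real.log (μ j)
  have hψ : Measurable ψ := by
    have h1 : ∀ j, Measurable fun x : Simplex p => x j := Simplex.measurable_coord
    exact (WithLp.measurable_toLp 2 _).comp
      (measurable_pi_lambda _ fun j => ((h1 j).log).sub_const _)
  have hΦ : Measurable fun x => (B (θ₀⁻¹ • ψ x)).ofLp := by fun_prop
  refine ⟨fun x => (B (θ₀⁻¹ • ψ x)).ofLp, hΦ, fun x y => ?_, ?_⟩
  · have h1 : ∑ k, ((B (θ₀⁻¹ • ψ x)).ofLp k - (B (θ₀⁻¹ • ψ y)).ofLp k) ^ 2 =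
        ‖B (θ₀⁻¹ • (ψ x - ψ y))‖ ^ 2 := by
      rw [EuclideanSpace.real_norm_sq_eq, smul_sub, map_sub]
      rfl
    rw [h1, map_smul, norm_smul, mul_pow, hBn, Simplex.dist_sq, norm_inv, Real.norm_eq_abs, inv_pow,
      sq_abs, mul_inv_cancel_left₀ (by positivity)]
    simp [ψ]
  · have hlog : Measurable fun z : Set.Ioi (0 : ℝ) => Real.log (z : ℝ) := by fun_prop
    have h2 : (fun x => (B (θ₀⁻¹ • ψ x)).ofLp) ∘ randomComposition hp μ (fun _ => θ₀) hμ =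
        WithLp.ofLp ∘ B ∘ WithLp.toLp 2 ∘ fun (z : Fin p → Set.Ioi (0 : ℝ)) j =>
          Real.log (z j : ℝ) := by
      funext z
      simp only [Function.comp_apply]
      congr 1
      -- The logarithm of the normalising sum is common to all coordinates, hence a multiple of the
      -- constant vector, which `B` annihilates.
      have h3 : θ₀⁻¹ • ψ (randomComposition hp μ (fun _ => θ₀) hμ z) =
          WithLp.toLp 2 (fun j => Real.log (z j : ℝ)) -
            (θ₀⁻¹ * Real.log (∑ k, μ k * (z k : ℝ) ^ θ₀)) • WithLp.toLp 2 fun _ => (1 : ℝ) := by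
        ext j
        simp only [ψ, log_randomComposition, PiLp.smul_apply, PiLp.sub_apply, smul_eq_mul]
        field_simp
        ring
      rw [h3, map_sub, map_smul, hBu, smul_zero, sub_zero]
    rw [compositionalDistribution, Measure.map_map hΦ (measurable_randomComposition _ _ _ _), h2,
      ← Measure.map_map (by fun_prop) (by fun_prop), ← Measure.map_map (by fun_prop) (by fun_prop),
      ← Measure.map_map (by fun_prop) (by fun_prop),
      Measure.pi_map_pi (fun _ => hlog.aemeasurable)]
    simp_rw [hF]
    rw [map_pi_eq_stdGaussian, hBG, ← map_pi_eq_stdGaussian,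
      Measure.map_map (by fun_prop) (by fun_prop)]
    exact Measure.map_id

/-! ### Exact linearisation of the shape -/

section algebra

variable {ι : Type*} [Fintype ι]

/-- The numerator of the object shape of a sample from a Euclidean space, in terms of sample
moments. -/
noncomputable def shapeNumerator (n : ℕ) (y : ℕ → ι → ℝ) : ℝ :=
  (sampleMean n fun i => (∑ k, y i k ^ 2) ^ 2) + 3 * (sampleMean n fun i => ∑ k, y i k ^ 2) ^ 2 -
    4 * (∑ k, (sampleMean n fun i => (∑ l, y i l ^ 2) * y i k) * sampleMean n fun i => y i k) +
    4 * (∑ k, ∑ l, (sampleMean n fun i => y i k) * (sampleMean n fun i => y i l) *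
      sampleMean n fun i => y i k * y i l) -
    4 * (sampleMean n fun i => ∑ k, y i k ^ 2) * ∑ k, (sampleMean n fun i => y i k) ^ 2

/-- The denominator of the object shape of a sample from a Euclidean space, in terms of sample
moments. -/
noncomputable def shapeDenominator (n : ℕ) (y : ℕ → ι → ℝ) : ℝ :=
  2 * (sampleMean n fun i => (∑ k, y i k ^ 2) ^ 2) +
    2 * (sampleMean n fun i => ∑ k, y i k ^ 2) ^ 2 +
    4 * (∑ k, ∑ l, (sampleMean n fun i => y i k * y i l) ^ 2) -
    8 * ∑ k, (sampleMean n fun i => (∑ l, y i l ^ 2) * y i k) * sampleMean n fun i => y i k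

variable (ι) in
/-- The object shape of a standard Gaussian vector. -/
noncomputable def gaussianShape : ℝ := (2 * Fintype.card ι + 1) / (2 * Fintype.card ι + 4)

/-- The influence function, up to a constant factor, of the object shape at a standard Gaussian
distribution. -/
noncomputable def shapeInfluence (y : ι → ℝ) : ℝ :=
  ((Fintype.card ι : ℝ) - 1) / (Fintype.card ι + 2) * ((∑ k, y k ^ 2) ^ 2 -
    2 * (Fintype.card ι + 2) * (∑ k, y k ^ 2) + Fintype.card ι * (Fintype.card ι + 2))

/-- Centre the mean of ‖y‖² at q and the second moment matrix at the identity. Its trace is the mean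
of ‖y‖², so the linear terms left over involve only the means of ‖y‖⁴ and ‖y‖²; with the constants
they form the influence function. The identity is exact, without Taylor expansion. -/
theorem gaussianShape_mul_shapeDenominator_sub [DecidableEq ι] {n : ℕ} (hn : n ≠ 0)
    (y : ℕ → ι → ℝ) :
    gaussianShape ι * shapeDenominator n y - shapeNumerator n y =
      (sampleMean n fun i => shapeInfluence (y i)) +
      ((2 * gaussianShape ι - 3) *
          (sampleMean n fun i => ∑ k, y i k ^ 2 - Fintype.card ι) ^ 2 +
        4 * gaussianShape ι *
          (∑ k, ∑ l, (sampleMean n fun i => y i k * y i l - if k = l then 1 else 0) ^ 2) -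
        (8 * gaussianShape ι - 4) * (∑ k, (sampleMean n fun i => (∑ l, y i l ^ 2) * y i k) *
          sampleMean n fun i => y i k) -
        4 * (∑ k, ∑ l, (sampleMean n fun i => y i k) * (sampleMean n fun i => y i l) *
          sampleMean n fun i => y i k * y i l) +
        4 * (sampleMean n fun i => ∑ k, y i k ^ 2) *
          ∑ k, (sampleMean n fun i => y i k) ^ 2) := by
  have h1 : (∑ k, ∑ l, (sampleMean n fun i => y i k * y i l - if k = l then 1 else 0) ^ 2) =
      (∑ k, ∑ l, (sampleMean n fun i => y i k * y i l) ^ 2) -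
        2 * (sampleMean n fun i => ∑ k, y i k ^ 2) + Fintype.card ι := by
    simp_rw [sampleMean_sub, sampleMean_const hn, sub_sq, Finset.sum_add_distrib,
      Finset.sum_sub_distrib, sampleMean_sum]
    simp [← Finset.mul_sum, pow_two]
  have h2 : (sampleMean n fun i => shapeInfluence (y i)) =
      ((Fintype.card ι : ℝ) - 1) / (Fintype.card ι + 2) *
      ((sampleMean n fun i => (∑ k, y i k ^ 2) ^ 2) - 2 * (Fintype.card ι + 2) *
        (sampleMean n fun i => ∑ k, y i k ^ 2) + Fintype.card ι * (Fintype.card ι + 2)) := by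
    simp only [shapeInfluence, sampleMean_const_mul, sampleMean_add, sampleMean_sub,
      sampleMean_const hn]
  rw [h1, h2, sampleMean_sub, sampleMean_const hn, shapeDenominator, shapeNumerator, gaussianShape]
  have hq : (2 * (Fintype.card ι : ℝ) + 4) ≠ 0 := by positivity
  have hq' : ((Fintype.card ι : ℝ) + 2) ≠ 0 := by positivity
  field_simp
  ring

end algebra

/-! ### Asymptotics for a standard Gaussian sample -/

section gaussianSample

variable {ι : Type*} [Fintype ι]

theorem integral_sqNorm_sq :
    ∫ y, (∑ k, y k ^ 2) ^ 2 ∂gaussianPi ι = Fintype.card ι * (Fintype.card ι + 2) :=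
  (integral_sqNorm_pow Finset.univ).2.1

theorem integral_sqNorm : ∫ y, ∑ k, y k ^ 2 ∂gaussianPi ι = Fintype.card ι := by
  simpa using (integral_sqNorm_pow (ι := ι) Finset.univ).1

theorem measurable_shapeInfluence : Measurable (shapeInfluence (ι := ι)) := by
  unfold shapeInfluence
  fun_prop

theorem hasFiniteMoments_shapeInfluence :
    HasFiniteMoments (shapeInfluence (ι := ι)) (gaussianPi ι) := by
  have h := hasFiniteMoments_sqNorm (ι := ι) Finset.univ
  unfold shapeInfluence
  exact (((h.pow 2).sub (h.const_mul _)).add (.const _)).const_mul _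

theorem integral_shapeInfluence : ∫ y, shapeInfluence y ∂gaussianPi ι = 0 := by
  have h := hasFiniteMoments_sqNorm (ι := ι) Finset.univ
  simp only [shapeInfluence]
  rw [integral_const_mul, integral_add ((h.pow 2).sub (h.const_mul _)).integrable
    (integrable_const _), integral_sub (h.pow 2).integrable (h.const_mul _).integrable,
    integral_const_mul, integral_sqNorm, integral_sqNorm_sq, integral_const]
  simp only [probReal_univ, smul_eq_mul, one_mul]
  ring

theorem integral_shapeInfluence_sq : ∫ y, shapeInfluence y ^ 2 ∂gaussianPi ι =
    8 * (Fintype.card ι : ℝ) * (Fintype.card ι - 1) ^ 2 / (Fintype.card ι + 2) := by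
  set q := (Fintype.card ι : ℝ) with hq
  have hq2 : q + 2 ≠ 0 := by positivity
  have h := hasFiniteMoments_sqNorm (ι := ι) Finset.univ
  obtain ⟨m1, m2, m3, m4⟩ := integral_sqNorm_pow (ι := ι) Finset.univ
  rw [Finset.card_univ, ← hq] at m1 m2 m3 m4
  have h1 : ∀ y : ι → ℝ, shapeInfluence y ^ 2 = ((q - 1) / (q + 2)) ^ 2 *
      ((∑ k, y k ^ 2) ^ 4 - 4 * (q + 2) * (∑ k, y k ^ 2) ^ 3 +
        (4 * (q + 2) ^ 2 + 2 * q * (q + 2)) * (∑ k, y k ^ 2) ^ 2 -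
        4 * q * (q + 2) ^ 2 * (∑ k, y k ^ 2) ^ 1 + (q * (q + 2)) ^ 2) := fun y => by
    rw [shapeInfluence, ← hq]
    ring
  simp_rw [h1]
  have i4 := h.pow 4
  have i3 := (h.pow 3).const_mul (4 * (q + 2))
  have i2 := (h.pow 2).const_mul (4 * (q + 2) ^ 2 + 2 * q * (q + 2))
  have i1 := (h.pow 1).const_mul (4 * q * (q + 2) ^ 2)
  rw [integral_const_mul, integral_add (((i4.sub i3).add i2).sub i1).integrable
    (integrable_const _), integral_sub ((i4.sub i3).add i2).integrable i1.integrable,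
    integral_add (i4.sub i3).integrable i2.integrable, integral_sub i4.integrable i3.integrable,
    integral_const_mul, integral_const_mul, integral_const_mul, m1, m2, m3, m4, integral_const]
  simp only [probReal_univ, smul_eq_mul, one_mul]
  field_simp
  ring

theorem shapeDenominator_eq_sampleAverage {Ω : Type*} (Y : ℕ → Ω → ι → ℝ) (n : ℕ) (ω : Ω) :
    (shapeDenominator n fun i => Y i ω) =
      2 * sampleAverage Y (fun y => (∑ k, y k ^ 2) ^ 2) n ω +
      2 * sampleAverage Y (fun y => ∑ k, y k ^ 2) n ω ^ 2 +
      4 * (∑ k, ∑ l, sampleAverage Y (fun y => y k * y l) n ω ^ 2) -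
      8 * ∑ k, sampleAverage Y (fun y => (∑ l, y l ^ 2) * y k) n ω *
        sampleAverage Y (fun y => y k) n ω := rfl

variable {Ω : Type*} [MeasurableSpace Ω] {Pr : Measure Ω} {Y : ℕ → Ω → ι → ℝ}

theorem tendsto_shapeDenominator_ae (hY : ∀ i, HasLaw (Y i) (gaussianPi ι) Pr)
    (hindep : iIndepFun Y Pr) :
    ∀ᵐ ω ∂Pr, Tendsto (fun n => shapeDenominator n fun i => Y i ω) atTop
      (𝓝 (4 * Fintype.card ι * (Fintype.card ι + 2))) := by
  classical
  have hR := hasFiniteMoments_sqNorm (ι := ι) Finset.univ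
  have hE := hasFiniteMoments_eval (ι := ι)
  have h4 := tendsto_sampleAverage_ae hY hindep (f := fun y : ι → ℝ => (∑ k, y k ^ 2) ^ 2) (by fun_prop)
    (hR.pow 2).integrable
  have h2 := tendsto_sampleAverage_ae hY hindep (f := fun y : ι → ℝ => ∑ k, y k ^ 2) (by fun_prop)
    hR.integrable
  have hT := fun k l : ι => tendsto_sampleAverage_ae hY hindep (f := fun y : ι → ℝ => y k * y l) (by fun_prop)
    ((hE k).mul (hE l)).integrable
  have hC := fun k : ι => tendsto_sampleAverage_ae hY hindep (f := fun y : ι → ℝ => (∑ l, y l ^ 2) * y k)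
    (by fun_prop) (hR.mul (hE k)).integrable
  have hb := fun k : ι => tendsto_sampleAverage_ae hY hindep (f := fun y : ι → ℝ => y k) (by fun_prop)
    (hE k).integrable
  have hT' := ae_all_iff.2 fun k : ι => ae_all_iff.2 (hT k)
  filter_upwards [h4, h2, hT', ae_all_iff.2 hC, ae_all_iff.2 hb] with ω h4 h2 hT hC hb
  have h := (((h4.const_mul 2).add ((h2.pow 2).const_mul 2)).add
    ((tendsto_finsetSum Finset.univ fun k _ =>
      tendsto_finsetSum Finset.univ fun l _ => (hT k l).pow 2).const_mul 4)).sub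
    ((tendsto_finsetSum Finset.univ fun k _ => (hC k).mul (hb k)).const_mul 8)
  simp_rw [shapeDenominator_eq_sampleAverage]
  convert h using 2
  -- The last sum vanishes since the mean is zero; the rest is 2q(q + 2) + 2q² + 4q.
  have hb0 : ∀ k, ∫ y, y k ∂gaussianPi ι = 0 := fun k =>
    integral_eq_zero_of_odd (by fun_prop) fun y => rfl
  simp only [integral_sqNorm, integral_sqNorm_sq, integral_eval_mul_eval_gaussianPi, hb0,
    mul_zero, Finset.sum_const_zero, sub_zero, ite_pow, one_pow, ne_eq, OfNat.ofNat_ne_zero,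
    not_false_eq_true, zero_pow, Finset.sum_ite_eq, Finset.mem_univ, if_true, Finset.sum_const,
    Finset.card_univ, nsmul_eq_mul, mul_one]
  ring

theorem aemeasurable_shapeDenominator (hY : ∀ i, HasLaw (Y i) (gaussianPi ι) Pr) (n : ℕ) :
    AEMeasurable (fun ω => shapeDenominator n fun i => Y i ω) Pr := by
  have h4 := aemeasurable_sampleAverage hY (f := fun y : ι → ℝ => (∑ k, y k ^ 2) ^ 2) (by fun_prop) n
  have h2 := aemeasurable_sampleAverage hY (f := fun y : ι → ℝ => ∑ k, y k ^ 2) (by fun_prop) n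
  have hT := fun k l : ι => aemeasurable_sampleAverage hY (f := fun y : ι → ℝ => y k * y l) (by fun_prop) n
  have hC := fun k : ι => aemeasurable_sampleAverage hY (f := fun y : ι → ℝ => (∑ l, y l ^ 2) * y k)
    (by fun_prop) n
  have hb := fun k : ι => aemeasurable_sampleAverage hY (f := fun y : ι → ℝ => y k) (by fun_prop) n
  exact (((h4.const_mul 2).add ((h2.pow_const 2).const_mul 2)).add
    ((Finset.aemeasurable_fun_sum _ fun k _ => Finset.aemeasurable_fun_sum _ fun l _ =>
      (hT k l).pow_const 2).const_mul 4)).sub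
    ((Finset.aemeasurable_fun_sum _ fun k _ => (hC k).mul (hb k)).const_mul 8)

theorem aemeasurable_shapeNumerator (hY : ∀ i, HasLaw (Y i) (gaussianPi ι) Pr) (n : ℕ) :
    AEMeasurable (fun ω => shapeNumerator n fun i => Y i ω) Pr := by
  have h4 := aemeasurable_sampleAverage hY (f := fun y : ι → ℝ => (∑ k, y k ^ 2) ^ 2) (by fun_prop) n
  have h2 := aemeasurable_sampleAverage hY (f := fun y : ι → ℝ => ∑ k, y k ^ 2) (by fun_prop) n
  have hT := fun k l : ι => aemeasurable_sampleAverage hY (f := fun y : ι → ℝ => y k * y l) (by fun_prop) n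
  have hC := fun k : ι => aemeasurable_sampleAverage hY (f := fun y : ι → ℝ => (∑ l, y l ^ 2) * y k)
    (by fun_prop) n
  have hb := fun k : ι => aemeasurable_sampleAverage hY (f := fun y : ι → ℝ => y k) (by fun_prop) n
  exact (((h4.add ((h2.pow_const 2).const_mul 3)).sub
    ((Finset.aemeasurable_fun_sum _ fun k _ => (hC k).mul (hb k)).const_mul 4)).add
    ((Finset.aemeasurable_fun_sum _ fun k _ => Finset.aemeasurable_fun_sum _ fun l _ =>
      ((hb k).mul (hb l)).mul (hT k l)).const_mul 4)).sub
    ((h2.const_mul 4).mul (Finset.aemeasurable_fun_sum _ fun k _ => (hb k).pow_const 2))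

variable [IsProbabilityMeasure Pr]

/-- The product of two centred sample averages and a convergent sequence is negligible at the scale
`n ^ (-1/2)`. -/
theorem tendstoInMeasure_sqrt_mul_sampleAverage_mul_mul {f g : (ι → ℝ) → ℝ} {S : ℕ → Ω → ℝ} {s : ℝ}
    (hY : ∀ i, HasLaw (Y i) (gaussianPi ι) Pr) (hindep : iIndepFun Y Pr)
    (hf : Measurable f) (hf2 : HasFiniteMoments f (gaussianPi ι))
    (hf0 : ∫ y, f y ∂gaussianPi ι = 0)
    (hg : Measurable g) (hg2 : HasFiniteMoments g (gaussianPi ι))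
    (hg0 : ∫ y, g y ∂gaussianPi ι = 0) (hSm : ∀ n, AEMeasurable (S n) Pr)
    (hS : ∀ᵐ ω ∂Pr, Tendsto (fun n => S n ω) atTop (𝓝 s)) :
    (∀ n : ℕ, AEMeasurable (fun ω => √(n : ℝ) * (sampleAverage Y f n ω * sampleAverage Y g n ω) *
      S n ω) Pr) ∧
    TendstoInMeasure Pr (fun (n : ℕ) ω =>
      √(n : ℝ) * (sampleAverage Y f n ω * sampleAverage Y g n ω) * S n ω) atTop fun _ => 0 := by
  have h : ∀ n : ℕ, AEMeasurable
      (fun ω => √(n : ℝ) * (sampleAverage Y f n ω * sampleAverage Y g n ω)) Pr := fun n =>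
    ((aemeasurable_sampleAverage hY hf n).mul (aemeasurable_sampleAverage hY hg n)).const_mul _
  exact ⟨fun n => (h n).mul (hSm n), tendstoInMeasure_zero_mul h hSm
    (tendstoInMeasure_sqrt_mul_sampleAverage_mul hY hindep hf hf2.memLp_two hf0 hg
      hg2.memLp_two hg0) hS⟩

/-- The object shape of a standard Gaussian sample is asymptotically linear. -/
theorem tendstoInMeasure_shape_remainder (hY : ∀ i, HasLaw (Y i) (gaussianPi ι) Pr)
    (hindep : iIndepFun Y Pr) :
    TendstoInMeasure Pr (fun (n : ℕ) ω => √(n : ℝ) *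
      (gaussianShape ι * (shapeDenominator n fun i => Y i ω) - (shapeNumerator n fun i => Y i ω) -
        sampleAverage Y shapeInfluence n ω)) atTop fun _ => 0 := by
  classical
  have hR := hasFiniteMoments_sqNorm (ι := ι) Finset.univ
  have hE := hasFiniteMoments_eval (ι := ι)
  have b0 : ∀ k, ∫ y, y k ∂gaussianPi ι = 0 := fun k =>
    integral_eq_zero_of_odd (by fun_prop) fun y => rfl
  have C0 : ∀ k, ∫ y, (∑ l, y l ^ 2) * y k ∂gaussianPi ι = 0 := fun k =>
    integral_eq_zero_of_odd (by fun_prop) fun y => by simp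
  have R0 : ∫ y, (∑ k, y k ^ 2 - Fintype.card ι) ∂gaussianPi ι = 0 := by
    rw [integral_sub hR.integrable (integrable_const _), integral_sqNorm, integral_const]
    simp
  have T0 : ∀ k l, ∫ y, (y k * y l - if k = l then 1 else 0) ∂gaussianPi ι = 0 := fun k l => by
    rw [integral_sub ((hE k).mul (hE l)).integrable (integrable_const _),
      integral_eval_mul_eval_gaussianPi, integral_const]
    simp
  have hT : ∀ k l, HasFiniteMoments (fun y : ι → ℝ => y k * y l - if k = l then 1 else 0)
    (gaussianPi ι) := fun k l => ((hE k).mul (hE l)).sub (.const _)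
  have hR' : HasFiniteMoments (fun y : ι → ℝ => ∑ k, y k ^ 2 - Fintype.card ι) (gaussianPi ι) :=
    hR.sub (.const _)
  have hconst : ∀ c : ℝ, ∀ᵐ ω ∂Pr, Tendsto (fun _ : ℕ => c) atTop (𝓝 c) :=
    fun c => ae_of_all _ fun _ => tendsto_const_nhds
  have mE : ∀ k, Measurable fun y : ι → ℝ => y k := measurable_pi_apply
  have mR : Measurable fun y : ι → ℝ => ∑ k, y k ^ 2 := by fun_prop
  have mR' : Measurable fun y : ι → ℝ => ∑ k, y k ^ 2 - (Fintype.card ι : ℝ) := mR.sub_const _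
  have mP : ∀ k l, Measurable fun y : ι → ℝ => y k * y l := fun k l => (mE k).mul (mE l)
  have mT : ∀ k l, Measurable fun y : ι → ℝ => y k * y l - if k = l then 1 else 0 :=
    fun k l => (mP k l).sub_const _
  have mC : ∀ k, Measurable fun y : ι → ℝ => (∑ l, y l ^ 2) * y k := fun k => mR.mul (mE k)
  -- One negligible family for each term of the remainder. The convergent factor carries the
  -- coefficient, and in `r4` and `r5` also a sample average that is not centred.
  have r1 := tendstoInMeasure_sqrt_mul_sampleAverage_mul_mul hY hindep mR' hR' R0
    mR' hR' R0 (fun _ => aemeasurable_const) (hconst (2 * gaussianShape ι - 3))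
  have r2 := fun k l : ι => tendstoInMeasure_sqrt_mul_sampleAverage_mul_mul hY hindep (mT k l)
    (hT k l) (T0 k l) (mT k l) (hT k l) (T0 k l) (fun _ => aemeasurable_const)
    (hconst (4 * gaussianShape ι))
  have r3 := fun k : ι => tendstoInMeasure_sqrt_mul_sampleAverage_mul_mul hY hindep (mC k)
    (hR.mul (hE k)) (C0 k) (mE k) (hE k) (b0 k) (fun _ => aemeasurable_const)
    (hconst (-(8 * gaussianShape ι - 4)))
  have r4 := fun k l : ι => tendstoInMeasure_sqrt_mul_sampleAverage_mul_mul
    (S := fun n ω => -4 * sampleAverage Y (fun y => y k * y l) n ω) hY hindep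
    (mE k) (hE k) (b0 k) (mE l) (hE l) (b0 l)
    (fun n => (aemeasurable_sampleAverage hY (mP k l) n).const_mul _)
    ((tendsto_sampleAverage_ae hY hindep (mP k l) ((hE k).mul (hE l)).integrable).mono
      fun ω h => h.const_mul (-4))
  have r5 := fun k : ι => tendstoInMeasure_sqrt_mul_sampleAverage_mul_mul
    (S := fun n ω => 4 * sampleAverage Y (fun y => ∑ l, y l ^ 2) n ω) hY hindep
    (mE k) (hE k) (b0 k) (mE k) (hE k) (b0 k)
    (fun n => (aemeasurable_sampleAverage hY mR n).const_mul _)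
    ((tendsto_sampleAverage_ae hY hindep mR hR.integrable).mono fun ω h => h.const_mul 4)
  have m2 := fun k n => Finset.aemeasurable_fun_sum Finset.univ fun l _ => (r2 k l).1 n
  have m4 := fun k n => Finset.aemeasurable_fun_sum Finset.univ fun l _ => (r4 k l).1 n
  have s2 := tendstoInMeasure_zero_sum Finset.univ m2 fun k _ =>
    tendstoInMeasure_zero_sum Finset.univ (fun l => (r2 k l).1) fun l _ => (r2 k l).2
  have s3 := tendstoInMeasure_zero_sum Finset.univ (fun k => (r3 k).1) fun k _ => (r3 k).2
  have s4 := tendstoInMeasure_zero_sum Finset.univ m4 fun k _ =>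
    tendstoInMeasure_zero_sum Finset.univ (fun l => (r4 k l).1) fun l _ => (r4 k l).2
  have s5 := tendstoInMeasure_zero_sum Finset.univ (fun k => (r5 k).1) fun k _ => (r5 k).2
  have n2 := fun n => Finset.aemeasurable_fun_sum Finset.univ fun k _ => m2 k n
  have n3 := fun n => Finset.aemeasurable_fun_sum Finset.univ fun k _ => (r3 k).1 n
  have n4 := fun n => Finset.aemeasurable_fun_sum Finset.univ fun k _ => m4 k n
  have n5 := fun n => Finset.aemeasurable_fun_sum Finset.univ fun k _ => (r5 k).1 n
  have t2 := tendstoInMeasure_zero_add r1.1 n2 r1.2 s2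
  have t3 := tendstoInMeasure_zero_add (fun n => (r1.1 n).add (n2 n)) n3 t2 s3
  have t4 := tendstoInMeasure_zero_add (fun n => ((r1.1 n).add (n2 n)).add (n3 n)) n4 t3 s4
  have t5 := tendstoInMeasure_zero_add (fun n => (((r1.1 n).add (n2 n)).add (n3 n)).add (n4 n))
    n5 t4 s5
  refine t5.congr_left fun n => ae_of_all _ fun ω => ?_
  rcases eq_or_ne n 0 with rfl | hn
  · simp
  simp only [Pi.add_apply]
  rw [gaussianShape_mul_shapeDenominator_sub hn]
  have h4 : (∑ k, ∑ l, √(n : ℝ) * (sampleAverage Y (fun y => y k) n ω *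
      sampleAverage Y (fun y => y l) n ω) * (-4 * sampleAverage Y (fun y => y k * y l) n ω)) =
      √(n : ℝ) * (-4) * ∑ k, ∑ l, sampleAverage Y (fun y => y k) n ω *
        sampleAverage Y (fun y => y l) n ω * sampleAverage Y (fun y => y k * y l) n ω := by
    simp_rw [Finset.mul_sum]
    exact Finset.sum_congr rfl fun k _ => Finset.sum_congr rfl fun l _ => by ring
  rw [h4]
  simp only [← Finset.sum_mul, ← Finset.mul_sum, sampleAverage, ← pow_two]
  generalize (sampleMean n fun i => ∑ k, Y i ω k ^ 2 - (Fintype.card ι : ℝ)) = A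
  ring

/-- Slutsky's lemma: the linear part times D⁻¹ has the Gaussian limit, and the rest tends to zero in
probability. A nonempty index type keeps the limit κ of D away from zero. -/
theorem tendstoInDistribution_shape [Nonempty ι] (hY : ∀ i, HasLaw (Y i) (gaussianPi ι) Pr)
    (hindep : iIndepFun Y Pr) :
    TendstoInDistribution (fun (n : ℕ) ω => √(n : ℝ) * (gaussianShape ι -
        (shapeNumerator n fun i => Y i ω) / shapeDenominator n fun i => Y i ω))
      atTop (id : ℝ → ℝ) (fun _ => Pr) (gaussianReal 0 (Real.toNNReal
        (((Fintype.card ι : ℝ) - 1) ^ 2 /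
          (2 * ((Fintype.card ι : ℝ) + 2) ^ 3 * Fintype.card ι)))) := by
  have hq : (0 : ℝ) < Fintype.card ι := by exact_mod_cast Fintype.card_pos
  set κ := (4 * Fintype.card ι * (Fintype.card ι + 2) : ℝ) with hκ
  have hκ0 : κ ≠ 0 := by positivity
  have mD := aemeasurable_shapeDenominator hY
  have mDinv : ∀ n, AEMeasurable (fun ω => (shapeDenominator n fun i => Y i ω)⁻¹) Pr :=
    fun n => (mD n).inv
  have mN := aemeasurable_shapeNumerator hY
  have mI := aemeasurable_sampleAverage hY measurable_shapeInfluence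
  have hD := tendsto_shapeDenominator_ae hY hindep
  rw [← hκ] at hD
  have hDinv : ∀ᵐ ω ∂Pr, Tendsto (fun n => (shapeDenominator n fun i => Y i ω)⁻¹) atTop
      (𝓝 κ⁻¹) := hD.mono fun ω h => h.inv₀ hκ0
  have hmain := (tendstoInDistribution_sqrt_mul_sampleAverage hY hindep measurable_shapeInfluence
    hasFiniteMoments_shapeInfluence.memLp_two integral_shapeInfluence
    ).continuous_comp_prodMk_of_tendstoInMeasure_const (g := fun z : ℝ × ℝ => z.1 * z.2)
    (by fun_prop) (tendstoInMeasure_of_tendsto_ae (fun n => (mDinv n).aestronglyMeasurable) hDinv)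
    mDinv
  -- Where D = 0 the quotient N / D is 0 by convention, and √n γ is left over. This term records it;
  -- almost surely it is eventually zero because D tends to κ ≠ 0.
  have hdeg : TendstoInMeasure Pr (fun (n : ℕ) ω => √(n : ℝ) * gaussianShape ι *
      (1 - (shapeDenominator n fun i => Y i ω) * (shapeDenominator n fun i => Y i ω)⁻¹)) atTop
      fun _ => 0 := by
    refine tendstoInMeasure_of_tendsto_ae (fun n => AEMeasurable.aestronglyMeasurable (by fun_prop))
      (hD.mono fun ω h => ?_)
    refine tendsto_const_nhds.congr' ?_
    filter_upwards [h.eventually_ne hκ0] with n hn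
    rw [mul_inv_cancel₀ hn, sub_self, mul_zero]
  have hrem := tendstoInMeasure_zero_add (fun n => by fun_prop) (fun n => by fun_prop)
    (tendstoInMeasure_zero_mul (fun n => by fun_prop) mDinv
      (tendstoInMeasure_shape_remainder hY hindep) hDinv) hdeg
  have h := tendstoInDistribution_of_tendstoInMeasure_sub
    (fun (n : ℕ) ω => √(n : ℝ) * (gaussianShape ι -
        (shapeNumerator n fun i => Y i ω) / shapeDenominator n fun i => Y i ω)) _ hmain
    (hrem.congr_left fun n => ae_of_all _ fun ω => ?_) (fun n => by fun_prop)
  -- Division by κ = 4q(q + 2) turns the variance 8q(q - 1)²/(q + 2) into (q - 1)²/(2q(q + 2)³).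
  · have hmap : (gaussianReal 0 (∫ y, shapeInfluence y ^ 2 ∂gaussianPi ι).toNNReal).map
        (fun z => id z * κ⁻¹) = gaussianReal 0 (Real.toNNReal
          (((Fintype.card ι : ℝ) - 1) ^ 2 /
            (2 * ((Fintype.card ι : ℝ) + 2) ^ 3 * Fintype.card ι))) := by
      simp only [id]
      rw [gaussianReal_map_mul_const, mul_zero, integral_shapeInfluence_sq]
      congr 1
      rw [← NNReal.coe_inj, NNReal.coe_mul, Real.coe_toNNReal _ (by positivity),
        Real.coe_toNNReal _ (by positivity), NNReal.coe_mk, hκ]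
      field_simp
      ring
    refine ⟨h.forall_aemeasurable, aemeasurable_id, ?_⟩
    have hlim := h.tendsto
    simp only [hmap] at hlim
    simp only [Measure.map_id]
    exact hlim
  · simp only [Pi.sub_apply]
    rcases eq_or_ne (shapeDenominator n fun i => Y i ω) 0 with h0 | h0
    · simp [h0]
    · field_simp
      ring

end gaussianSample

/-! ### Transfer to the simplex -/

/-- Scale invariance: numerator and denominator are both of degree four in the distance, so θ₀⁴
cancels. -/
theorem objectShape_empiricalDistribution_eq {p : ℕ} {ι : Type*} [Fintype ι] {θ₀ : ℝ} (hθ₀ : 0 < θ₀)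
    {Φ : Simplex p → ι → ℝ} (hΦ : ∀ x y, dist x y ^ 2 = θ₀ ^ 2 * ∑ k, (Φ x k - Φ y k) ^ 2)
    {n : ℕ} (hn : n ≠ 0) (x : ℕ → Simplex p) :
    objectShape (empiricalDistribution n x) =
      (shapeNumerator n fun i => Φ (x i)) / shapeDenominator n fun i => Φ (x i) := by
  have h4 : ∀ i j, dist (x i) (x j) ^ 4 = (θ₀ ^ 2 * ∑ k, (Φ (x i) k - Φ (x j) k) ^ 2) ^ 2 :=
    fun i j => by rw [← hΦ]; ring
  rw [objectShape_empiricalDistribution Simplex.measurable_dist hn]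
  simp_rw [h4, hΦ, mul_pow, sampleMean_const_mul, mul_pow, sampleMean_const_mul]
  rw [mul_div_mul_left _ _ (by positivity),
    sampleMean_sampleMean_sqDist_sq (fun i => Φ (x i)) hn,
    sampleMean_sampleMean_sqDist_pow_two (fun i => Φ (x i)) hn]
  rfl

theorem theorem7 {p : ℕ} (hp : 1 < p)
    (μ : Fin p → ℝ) (hμ : ∀ j, 0 < μ j) (θ₀ : ℝ) (hθ₀ : 0 < θ₀)
    -- the distribution of `Z`, a standard log-normal one
    (F : Measure (Set.Ioi (0 : ℝ))) [IsProbabilityMeasure F]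
    (hF : F.map (fun z : Set.Ioi (0 : ℝ) => Real.log (z : ℝ)) = gaussianReal 0 1)
    -- a random sample from the compositional distribution with `θ = θ₀ 1_p`
    {Ω : Type*} [MeasurableSpace Ω] (Pr : Measure Ω) [IsProbabilityMeasure Pr]
    (X : ℕ → Ω → Simplex p)
    (hX : ∀ i, HasLaw (X i) (compositionalDistribution hp F μ (fun _ => θ₀) hμ) Pr)
    (hindep : iIndepFun X Pr) :
    TendstoInDistribution
      (fun (n : ℕ) (ω : Ω) => √(n : ℝ) *
        ((2 * (p : ℝ) - 1) / (2 * (p : ℝ) + 2) -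
          objectShape (empiricalDistribution n fun i => X i ω)))
      atTop (id : ℝ → ℝ) (fun _ => Pr)
      (gaussianReal 0
        (Real.toNNReal (((p : ℝ) - 2) ^ 2 / (2 * ((p : ℝ) + 1) ^ 3 * ((p : ℝ) - 1))))) := by
  obtain ⟨Φ, hΦm, hΦd, hΦ⟩ := exists_gaussian_coordinates hp μ hμ hθ₀ F hF
  have hY : ∀ i, HasLaw (fun ω => Φ (X i ω)) (gaussianPi (Fin (p - 1))) Pr := fun i =>
    ⟨hΦm.comp_aemeasurable (hX i).aemeasurable, by
      rw [← hΦ, ← (hX i).map_eq, AEMeasurable.map_map_of_aemeasurable hΦm.aemeasurable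
        (hX i).aemeasurable]
      rfl⟩
  have : Nonempty (Fin (p - 1)) := ⟨⟨0, by omega⟩⟩
  have hcard : ((Fintype.card (Fin (p - 1)) : ℕ) : ℝ) = p - 1 := by
    rw [Fintype.card_fin, Nat.cast_sub hp.le, Nat.cast_one]
  have h := tendstoInDistribution_shape hY (hindep.comp (fun _ => Φ) fun _ => hΦm)
  have hshape : gaussianShape (Fin (p - 1)) = (2 * (p : ℝ) - 1) / (2 * (p : ℝ) + 2) := by
    rw [gaussianShape, hcard]
    congr 1 <;> ring
  have hvar : ((p : ℝ) - 1 - 1) ^ 2 / (2 * ((p : ℝ) - 1 + 2) ^ 3 * ((p : ℝ) - 1)) =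
      ((p : ℝ) - 2) ^ 2 / (2 * ((p : ℝ) + 1) ^ 3 * ((p : ℝ) - 1)) := by
    congr 1 <;> ring
  rw [hcard, hvar, hshape] at h
  refine TendstoInDistribution.congr (fun n => ae_of_all _ fun ω => ?_) (ae_eq_refl _) h
  -- For n = 0 the factor √n makes both sides zero.
  rcases eq_or_ne n 0 with rfl | hn
  · simp
  · simp only [objectShape_empiricalDistribution_eq hθ₀ hΦd hn]
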